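/- The L-surface is the closed region $([0,2]\times[0,1])\cup([0,1]\times[0,2])$, tiled by three unit squares, with opposite boundary edges identified by translation: $(x,0)\sim(x,2)$ for $0\le x\le 1$, $(x,0)\sim(x,1)$ for $1\le x\le 2$, $(0,y)\sim(2,y)$ for $0\le y\le 1$, and $(0,y)\sim(1,y)$ for $1\le y\le 2$. It carries the flat (path) metric. Its vertices are the images of the corners of the three squares. A half-infinite geodesic of slope $\alpha$ is a curve $\gamma(t)$, $t\ge 0$, on the L-surface, parametrized by arc length, that moves along straight lines in one constant direction of slope $\alpha$ and continues across identified edges; its starting point is arbitrary, and it is undefined after hitting a vertex at a time $t>0$. Theorem 6.1.1. Let $\alpha>1$ be badly approximable (that is, irrational with bounded continued fraction digits), with continued fraction $$\alpha=a_0+\cfrac{1}{a_1+\cfrac{1}{a_2+\cfrac{1}{a_3+\cdots}}},$$ where the digits $a_0,a_1,a_2,\ldots$ are all positive and even. Then every half-infinite geodesic of slope $\alpha$ on the L-surface which does not hit a vertex at a time $t>0$ is superdense: there is a constant $C=C(\alpha)>0$, depending only on $\alpha$, such that for every such geodesic, every integer $n\ge 1$ and every point $P$ of the L-surface, the initial segment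 of length $Cn$ of the geodesic contains a point at distance less than $1/n$ from $P$. -/

import Mathlib

open scoped ENNReal

noncomputable section

/-- The net of the L-surface: the closed L-shaped region tiled by the three unit squares
`[0,1] × [0,1]`, `[1,2] × [0,1]` and `[0,1] × [1,2]` of the Euclidean plane. -/
def LShape : Set (EuclideanSpace ℝ (Fin 2)) :=
  {p | (p 0 ∈ Set.Icc 0 2 ∧ p 1 ∈ Set.Icc 0 1) ∨ (p 0 ∈ Set.Icc 0 1 ∧ p 1 ∈ Set.Icc 0 2)}

/-- The identification of opposite boundary edges of the L-shape by perpendicular translation. -/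
inductive LGlue : LShape → LShape → Prop
  /-- `[0,1] × {0}` is glued to `[0,1] × {2}`. -/
  | h₁ (p q : LShape) : p.1 0 ∈ Set.Icc 0 1 → q.1 0 = p.1 0 → p.1 1 = 0 → q.1 1 = 2 → LGlue p q
  /-- `[1,2] × {0}` is glued to `[1,2] × {1}`. -/
  | h₂ (p q : LShape) : p.1 0 ∈ Set.Icc 1 2 → q.1 0 = p.1 0 → p.1 1 = 0 → q.1 1 = 1 → LGlue p q
  /-- `{0} × [0,1]` is glued to `{2} × [0,1]`. -/
  | v₁ (p q : LShape) : p.1 1 ∈ Set.Icc 0 1 → q.1 1 = p.1 1 → p.1 0 = 0 → q.1 0 = 2 → LGlue p q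
  /-- `{0} × [1,2]` is glued to `{1} × [1,2]`. -/
  | v₂ (p q : LShape) : p.1 1 ∈ Set.Icc 1 2 → q.1 1 = p.1 1 → p.1 0 = 0 → q.1 0 = 1 → LGlue p q

/-- The L-surface: the quotient of the L-shape by the equivalence relation generated by the
edge identifications. -/
def LSurface : Type := Quot LGlue

/-- The point of the L-surface represented by a point of the net. -/
def LSurface.mk (p : LShape) : LSurface := Quot.mk LGlue p

/-- A point of the L-surface is a vertex if it is represented by a corner of one of the three unit
squares, i.e. by a point of the net with integer coordinates. -/
def LSurface.IsVertex (x : LSurface) : Prop :=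
  ∃ (p : LShape) (i j : ℤ), p.1 0 = i ∧ p.1 1 = j ∧ x = LSurface.mk p

/-- `LSurface.IsPath x y ℓ`: there is a polygonal path on the L-surface from `x` to `y` of length
`ℓ`. Such a path is a finite succession of straight line segments of the net, where the
end point of each segment represents the same point of the surface as the starting point of the
next one. -/
inductive LSurface.IsPath (x : LSurface) : LSurface → ℝ → Prop
  | nil : LSurface.IsPath x x 0
  | step {ℓ : ℝ} (p q : LShape) : LSurface.IsPath x (LSurface.mk p) ℓ →
      segment ℝ p.1 q.1 ⊆ LShape → LSurface.IsPath x (LSurface.mk q) (ℓ + dist p.1 q.1)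

/-- The flat distance on the L-surface: the infimum of the lengths of the polygonal paths
joining two points. -/
def LSurface.flatEDist (x y : LSurface) : ℝ≥0∞ :=
  ⨅ (ℓ : ℝ) (_ : LSurface.IsPath x y ℓ), ENNReal.ofReal ℓ

/-- `γ`, restricted to times `t ≥ 0`, is a half-infinite geodesic on the L-surface with (constant)
velocity `v`. At every time it leaves, and at every positive time it also arrives, along a straight
line segment of the net traversed with velocity `v`; at positive times it does not hit a
vertex (where it would become undefined). The starting point may be any point, even a vertex.
Only the values `γ t` with `t ≥ 0` matter. -/
structure LSurface.IsHalfGeodesic (v : EuclideanSpace ℝ (Fin 2)) (γ : ℝ → LSurface) : Prop where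
  leaves : ∀ t : ℝ, 0 ≤ t → ∃ (p : EuclideanSpace ℝ (Fin 2)) (ε : ℝ), 0 < ε ∧
    ∀ u ∈ Set.Icc 0 ε, ∃ h : p + u • v ∈ LShape, γ (t + u) = LSurface.mk ⟨p + u • v, h⟩
  arrives : ∀ t : ℝ, 0 < t → ∃ (p : EuclideanSpace ℝ (Fin 2)) (ε : ℝ), 0 < ε ∧
    ∀ u ∈ Set.Icc 0 ε, ∃ h : p - u • v ∈ LShape, γ (t - u) = LSurface.mk ⟨p - u • v, h⟩
  avoids_vertices : ∀ t : ℝ, 0 < t → ¬ (γ t).IsVertex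

/-- The half-infinite curve `γ`, parametrized by arc length on `t ≥ 0`, is superdense with
constant `C`: for every integer `n ≥ 1` and every point `P` of the surface, the initial segment of
length `C n` gets `(1 / n)`-close to `P`. -/
def LSurface.IsSuperdenseWith (C : ℝ) (γ : ℝ → LSurface) : Prop :=
  ∀ n : ℕ, 1 ≤ n → ∀ P : LSurface, ∃ t ∈ Set.Icc (0 : ℝ) (C * n),
    LSurface.flatEDist (γ t) P < ENNReal.ofReal (1 / n)

/-- `α` has the infinite continued fraction expansion `[a 0; a 1, a 2, …]`. -/
def HasContFracDigits (α : ℝ) (a : ℕ → ℕ) : Prop :=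
  (GenContFract.of α).h = (a 0 : ℝ) ∧
    ∀ i : ℕ, (GenContFract.of α).partDens.get? i = some (a (i + 1) : ℝ)

/-- An irrational number is badly approximable if its continued fraction digits are bounded. -/
def IsBadlyApproximable (α : ℝ) : Prop :=
  Irrational α ∧
    ∃ C : ℝ, ∀ (i : ℕ) (b : ℝ), (GenContFract.of α).partDens.get? i = some b → b ≤ C

end

/-! Code a geodesic by its crossings with the horizontal edges of the squares. The position on the
edge rotates by θ = 1/α, while the square changes by `up`, preceded by `right` whenever the position
wraps around. Every row and column of the L has at most two squares, so `right` and `up` are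
involutions: two different transpositions of three labels.

The crossings with the vertical edges give a second coding of the same geodesic. If 1/θ = a + θ',
the height rises by a + θ' from one vertical edge to the next, so heights rotate by θ' and `up` is
applied a or a + 1 times. For even a this is `up` to the power 0 or 1: the second coding is of the
same kind as the first, for θ' and with the involutions interchanged. (Geometrically, an even
vertical shear is an affine automorphism of the L-surface.) This is `IsOrbit.renormalize`; iterating
it runs through the continued fraction.

Undoing one step (`Recurs.of_renormalized`) turns density ε before time N into density θε before
time (N + 2)/θ, so the product of scale and time stays bounded over any number of steps. Bounded
digits give a uniform start at ε = 1 (`IsEvenExpansion.recurs_one`) and make consecutive scales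
comparable, so every scale 1/K is reached in time O(K) (`IsEvenExpansion.exists_recurs`). Finally
`exists_rep_near` turns density of the coding into density on the surface. -/

noncomputable section

/-! ### Skew products over a rotation and their renormalization -/

/-- The sequence `(x m, f m)` is an orbit of the skew product over the rotation by `θ` of the unit
interval, where the label `f` changes by `v` at each step, and in addition by `h` when `x` wraps
around. -/
structure IsOrbit {X : Type*} (θ : ℝ) (h v : X → X) (x : ℕ → ℝ) (f : ℕ → X) : Prop where
  pos : ∀ m, 0 < x m
  lt_one : ∀ m, x m < 1
  step : ∀ m, (x (m + 1) = x m + θ ∧ f (m + 1) = v (f m)) ∨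
    (x (m + 1) = x m + θ - 1 ∧ f (m + 1) = v (h (f m)))

namespace IsOrbit

variable {X : Type*} {θ : ℝ} {h v : X → X} {x : ℕ → ℝ} {f : ℕ → X}

lemma of_lt (H : IsOrbit θ h v x f) {m : ℕ} (hm : x m + θ ≤ 1) :
    x m + θ < 1 ∧ x (m + 1) = x m + θ ∧ f (m + 1) = v (f m) := by
  rcases H.step m with h1 | h1
  · have := H.lt_one (m + 1)
    exact ⟨by linarith [h1.1], h1⟩
  · have := H.pos (m + 1)
    linarith [h1.1]

lemma of_gt (H : IsOrbit θ h v x f) {m : ℕ} (hm : 1 < x m + θ) :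
    x (m + 1) = x m + θ - 1 ∧ f (m + 1) = v (h (f m)) := by
  rcases H.step m with h1 | h1
  · have := H.lt_one (m + 1)
    linarith [h1.1]
  · exact h1

lemma run (H : IsOrbit θ h v x f) (hθ : 0 < θ) (m : ℕ) :
    ∀ j : ℕ, x m + j * θ ≤ 1 → x (m + j) = x m + j * θ ∧ f (m + j) = v^[j] (f m) := by
  intro j
  induction j with
  | zero => intro _; simp
  | succ j ih =>
    intro hj
    push_cast at hj
    obtain ⟨h1, h2⟩ := ih (by linarith)
    obtain ⟨_, h3, h4⟩ := H.of_lt (m := m + j) (by rw [h1]; linarith)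
    refine ⟨?_, ?_⟩
    · rw [← add_assoc, h3, h1]; push_cast; ring
    · rw [← add_assoc, h4, h2, Function.iterate_succ_apply']

/-- The first wrap around after time `m`. -/
lemma exists_wrap (H : IsOrbit θ h v x f) (hθ : 0 < θ) (m : ℕ) :
    ∃ j : ℕ, x m + j * θ < 1 ∧ 1 < x m + (j + 1) * θ ∧ x (m + j) = x m + j * θ ∧
      x (m + (j + 1)) = x m + (j + 1) * θ - 1 := by
  have hex : ∃ j : ℕ, 1 < x m + (j + 1) * θ := by
    obtain ⟨j, hj⟩ := exists_nat_gt (1 / θ)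
    refine ⟨j, ?_⟩
    rw [div_lt_iff₀ hθ] at hj
    nlinarith [H.pos m]
  classical
  have hmin : x m + (Nat.find hex : ℝ) * θ ≤ 1 := by
    rcases Nat.eq_zero_or_pos (Nat.find hex) with h0 | h0
    · rw [h0]; simpa using (H.lt_one m).le
    · have := Nat.find_min hex (Nat.sub_one_lt h0.ne')
      push Not at this
      have hc : ((Nat.find hex - 1 : ℕ) : ℝ) + 1 = (Nat.find hex : ℝ) := by
        exact_mod_cast Nat.sub_add_cancel h0
      rwa [hc] at this
  obtain ⟨h1, -⟩ := H.run hθ m _ hmin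
  have h2 := Nat.find_spec hex
  refine ⟨Nat.find hex, ?_, h2, h1, ?_⟩
  · have := H.lt_one (m + Nat.find hex)
    linarith
  · rw [← add_assoc, (H.of_gt (m := m + Nat.find hex) (by rw [h1]; linarith)).1, h1]
    ring

/-- Between two entries into (0, θ) there is a single wrap, at the last step. Evenness of a enters
through the label: the steps before the wrap apply v an odd number a - 1 of times, or an even number
a, which leaves v or the identity. -/
lemma pass (H : IsOrbit θ h v x f) (hθ : 0 < θ) {a : ℕ} (ha : Even a) (ha2 : 2 ≤ a) {θ' : ℝ}
    (hθ' : 0 < θ') (hθ1' : θ' < 1) (e : (a + θ') * θ = 1) (hv : Function.Involutive v)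
    {m : ℕ} (hm : x m < θ) :
    (θ' * θ < x m ∧ x (m + a) = x m - θ' * θ ∧ f (m + a) = v (h (v (f m)))) ∨
      (x m < θ' * θ ∧ x (m + (a + 1)) = x m + θ - θ' * θ ∧ f (m + (a + 1)) = v (h (f m))) := by
  have hp := H.pos m
  rcases lt_or_ge (θ' * θ) (x m) with hc | hc
  · left
    have hk : ((a - 1 : ℕ) : ℝ) = a - 1 := by rw [Nat.cast_sub (by omega)]; simp
    obtain ⟨h1, h2⟩ := H.run hθ m (a - 1) (by rw [hk]; nlinarith)
    obtain ⟨h3, h4⟩ := H.of_gt (m := m + (a - 1)) (by rw [h1, hk]; nlinarith)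
    have hodd : Odd (a - 1) := by
      rw [← Nat.not_even_iff_odd]
      intro h; exact absurd ha (by rw [show a = (a - 1) + 1 by omega]; simpa [Nat.even_add_one] using h)
    rw [hv.iterate_odd hodd] at h2
    rw [show m + (a - 1) + 1 = m + a by omega] at h3 h4
    refine ⟨hc, ?_, ?_⟩
    · rw [h3, h1, hk]; linarith
    · rw [h4, h2]
  · right
    obtain ⟨h1, h2⟩ := H.run hθ m a (by nlinarith)
    have h5 := H.lt_one (m + a)
    obtain ⟨h3, h4⟩ := H.of_gt (m := m + a) (by rw [h1]; nlinarith)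
    rw [hv.iterate_even ha] at h2
    refine ⟨by nlinarith, ?_, ?_⟩
    · rw [← add_assoc, h3, h1]; linarith
    · rw [← add_assoc, h4, h2]; rfl

open Classical in
/-- Renormalization: if `θ = 1 / (a + θ')` with `a` even, then the times at which an orbit for `θ`
enters `(0, θ)` after wrapping around define, after rescaling, an orbit for `θ'` in which
the roles of `h` and `v` are interchanged. -/
lemma renormalize (H : IsOrbit θ h v x f) (hθ : 0 < θ) {a : ℕ} (ha : Even a) (ha2 : 2 ≤ a)
    {θ' : ℝ} (hθ' : 0 < θ') (hθ1' : θ' < 1) (e : (a + θ') * θ = 1)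
    (hv : Function.Involutive v) :
    ∃ m : ℕ → ℕ, IsOrbit θ' v h (fun i => 1 - x (m i) / θ) (fun i => v (f (m i))) ∧
      ∀ i j : ℕ, x (m i) + j * θ ≤ 1 → x (m i + j) = x (m i) + j * θ ∧
        f (m i + j) = v^[j] (f (m i)) ∧ ((m i + j : ℕ) : ℝ) ≤ (i + 2) / θ := by
  obtain ⟨j₀, hj1, hj2, hj3, hj4⟩ := H.exists_wrap hθ 0
  simp only [zero_add] at hj3 hj4
  set m : ℕ → ℕ := fun i => Nat.rec (j₀ + 1)
    (fun _ k => if θ' * θ < x k then k + a else k + (a + 1)) i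
  have m0 : m 0 = j₀ + 1 := rfl
  have ms : ∀ i, m (i + 1) = if θ' * θ < x (m i) then m i + a else m i + (a + 1) := fun i => rfl
  -- Exactly i + 1 wraps precede the i-th entry; this count yields the time bound.
  have key : ∀ i, x (m i) < θ ∧ x (m i) = x 0 + m i * θ - (i + 1) := by
    intro i
    induction i with
    | zero =>
      rw [m0, hj4]; push_cast
      exact ⟨by linarith, by ring⟩
    | succ i ih =>
      obtain ⟨ih1, ih2⟩ := ih
      rw [ms]
      rcases H.pass hθ ha ha2 hθ' hθ1' e hv ih1 with ⟨c, h1, -⟩ | ⟨c, h1, -⟩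
      · rw [if_pos c, h1]
        refine ⟨by nlinarith, ?_⟩
        rw [ih2]; push_cast; linarith
      · rw [if_neg c.not_gt, h1]
        refine ⟨by linarith, ?_⟩
        rw [ih2]; push_cast; linarith
  -- In the geometric picture 1 - x/θ is the height at which the vertical edge was crossed just
  -- before this entry, and v (f) the square entered there. The reflection turns the return map, a
  -- rotation by -θ', into one by θ'.
  refine ⟨m, ⟨?_, ?_, ?_⟩, ?_⟩
  · intro i
    have := (div_lt_one hθ).2 (key i).1
    linarith
  · intro i
    have := div_pos (H.pos (m i)) hθ
    linarith
  · intro i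
    have hne := hθ.ne'
    rw [ms]
    rcases H.pass hθ ha ha2 hθ' hθ1' e hv (key i).1 with ⟨c, h1, h2⟩ | ⟨c, h1, h2⟩
    · left
      rw [if_pos c, h1, h2, hv]
      exact ⟨by field_simp; ring, rfl⟩
    · right
      rw [if_neg c.not_gt, h1, h2, hv, hv]
      exact ⟨by field_simp; ring, rfl⟩
  · intro i j hj
    obtain ⟨h1, h2⟩ := H.run hθ (m i) j hj
    refine ⟨h1, h2, ?_⟩
    rw [le_div_iff₀ hθ]
    have := H.pos 0
    have := (key i).2
    push_cast
    nlinarith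

end IsOrbit

/-! ### Transfer of recurrence through one renormalization -/

/-- Every orbit visits each label within distance `ε` of each point `y`, on the same side of
`1 - θ` as `y`, before time `N`. -/
def Recurs {X : Type*} (θ : ℝ) (h v : X → X) (ε N : ℝ) : Prop :=
  ∀ x f, IsOrbit θ h v x f → ∀ (g : X) (y : ℝ),
    (0 ≤ y → y ≤ 1 - θ → ∃ m : ℕ, (m : ℝ) ≤ N ∧ |x m - y| ≤ ε ∧ f m = g ∧ x m ≤ 1 - θ) ∧
    (1 - θ ≤ y → y ≤ 1 → ∃ m : ℕ, (m : ℝ) ≤ N ∧ |x m - y| ≤ ε ∧ f m = g ∧ 1 - θ ≤ x m)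

lemma Recurs.mono {X : Type*} {θ : ℝ} {h v : X → X} {ε N N' : ℝ} (H : Recurs θ h v ε N)
    (hN : N ≤ N') : Recurs θ h v ε N' := by
  intro x f hx g y
  refine ⟨fun h1 h2 => ?_, fun h1 h2 => ?_⟩
  · obtain ⟨m, hm, hm'⟩ := (H x f hx g y).1 h1 h2
    exact ⟨m, hm.trans hN, hm'⟩
  · obtain ⟨m, hm, hm'⟩ := (H x f hx g y).2 h1 h2
    exact ⟨m, hm.trans hN, hm'⟩

/-- Write y = θ(u + j): enter (0, θ) near θu, then take j steps. The entry is steered by a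
renormalized visit near 1 - u, whose error is contracted by θ. The cut 1 - θ' corresponds to the
entry θ'θ, from which a - 1 steps lead exactly to 1 - θ; this is how the side condition in `Recurs`
propagates. -/
lemma Recurs.of_renormalized {X : Type*} {θ θ' : ℝ} {h v : X → X} {ε N : ℝ} {a : ℕ}
    (hθ : 0 < θ) (ha : Even a) (ha2 : 2 ≤ a) (hθ' : 0 < θ') (hθ1' : θ' < 1)
    (e : (a + θ') * θ = 1) (hv : Function.Involutive v) (H : Recurs θ' v h ε N) :
    Recurs θ h v (θ * ε) ((N + 2) / θ) := by
  intro x f hx g y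
  obtain ⟨m, hO, hm⟩ := hx.renormalize hθ ha ha2 hθ' hθ1' e hv
  have hne := hθ.ne'
  have hinv : ∀ j : ℕ, v^[j] (v^[j] g) = g := fun j => by
    rw [← Function.iterate_add_apply, hv.iterate_even (Even.add_self j)]; rfl
  have conv : ∀ i (u : ℝ), |1 - x (m i) / θ - (1 - u)| ≤ ε → |x (m i) - θ * u| ≤ θ * ε := by
    intro i u hu
    rw [show x (m i) - θ * u = -(θ * (1 - x (m i) / θ - (1 - u))) by field_simp; ring, abs_neg,
      abs_mul, abs_of_pos hθ]
    exact mul_le_mul_of_nonneg_left hu hθ.le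
  have fin : ∀ (i j : ℕ) (u : ℝ), (i : ℝ) ≤ N → |1 - x (m i) / θ - (1 - u)| ≤ ε →
      v (f (m i)) = v (v^[j] g) → x (m i) + j * θ ≤ 1 → θ * (u + j) = y →
      ((m i + j : ℕ) : ℝ) ≤ (N + 2) / θ ∧ |x (m i + j) - y| ≤ θ * ε ∧ f (m i + j) = g ∧
        x (m i + j) = x (m i) + j * θ := by
    intro i j u hi hu hf hj hy
    obtain ⟨h1, h2, h3⟩ := hm i j hj
    refine ⟨h3.trans (by gcongr), ?_, ?_, h1⟩
    · have := conv i u hu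
      rw [h1, ← hy]
      convert this using 2
      ring
    · rw [h2, hv.injective hf, hinv]
  have lower : ∀ i, 1 - θ' ≤ 1 - x (m i) / θ → x (m i) ≤ θ' * θ := fun i hi => by
    rw [← div_le_iff₀ hθ]; linarith
  have upper : ∀ i, 1 - x (m i) / θ ≤ 1 - θ' → θ' * θ ≤ x (m i) := fun i hi => by
    rw [← le_div_iff₀ hθ]; linarith
  have xlt : ∀ i, x (m i) < θ := fun i => by
    have := hO.pos i
    rw [← div_lt_one hθ]; linarith
  refine ⟨fun h1 h2 => ?_, fun h1 h2 => ?_⟩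
  · set j := ⌊y / θ⌋₊
    have hj1 : (j : ℝ) ≤ y / θ := Nat.floor_le (by positivity)
    have hj2 : y / θ < j + 1 := Nat.lt_floor_add_one _
    have hyj : θ * ((y / θ - j) + j) = y := by field_simp; ring
    have hya : y / θ ≤ a + θ' - 1 := by
      rw [div_le_iff₀ hθ]; linarith
    have hja : j < a := by
      have : (j : ℝ) < a := by linarith
      exact_mod_cast this
    have hja' : (j : ℝ) + 1 ≤ a := by exact_mod_cast hja
    -- If u ≤ θ', an entry below θ'θ stays below 1 - θ even for j = a - 1. If u > θ', then j ≤ a - 2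
    -- and any entry below θ will do.
    rcases le_or_gt (y / θ - j) θ' with hc | hc
    · obtain ⟨i, hi, hi1, hi2, hi3⟩ := (H _ _ hO (v (v^[j] g)) (1 - (y / θ - j))).2
        (by linarith) (by linarith)
      have := lower i hi3
      obtain ⟨r1, r2, r3, r4⟩ := fin i j _ hi hi1 hi2 (by nlinarith) hyj
      exact ⟨_, r1, r2, r3, by rw [r4]; nlinarith⟩
    · have hja2 : (j : ℝ) + 2 ≤ a := by
        have : (j : ℝ) + 1 < a := by linarith
        exact_mod_cast this
      obtain ⟨i, hi, hi1, hi2, hi3⟩ := (H _ _ hO (v (v^[j] g)) (1 - (y / θ - j))).1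
        (by linarith) (by linarith)
      have := xlt i
      obtain ⟨r1, r2, r3, r4⟩ := fin i j _ hi hi1 hi2 (by nlinarith) hyj
      exact ⟨_, r1, r2, r3, by rw [r4]; nlinarith⟩
  · have hya : a - 1 + θ' ≤ y / θ := by
      rw [le_div_iff₀ hθ]; linarith
    have hya' : y / θ ≤ a + θ' := by
      rw [div_le_iff₀ hθ]; linarith
    -- On the wrapping side, y is reached by a steps from u ≤ θ' or by a - 1 steps from u ≥ θ'.
    rcases le_total (a : ℝ) (y / θ) with hc | hc
    · obtain ⟨i, hi, hi1, hi2, hi3⟩ := (H _ _ hO (v (v^[a] g)) (1 - (y / θ - a))).2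
        (by linarith) (by linarith)
      have := lower i hi3
      have := hx.pos (m i)
      obtain ⟨r1, r2, r3, r4⟩ := fin i a _ hi hi1 hi2 (by nlinarith) (by field_simp; ring)
      exact ⟨_, r1, r2, r3, by rw [r4]; nlinarith⟩
    · have hk : ((a - 1 : ℕ) : ℝ) = a - 1 := by rw [Nat.cast_sub (by omega)]; simp
      obtain ⟨i, hi, hi1, hi2, hi3⟩ := (H _ _ hO (v (v^[a - 1] g))
        (1 - (y / θ - (a - 1 : ℕ)))).1 (by rw [hk]; linarith) (by rw [hk]; linarith)
      have := upper i hi3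
      have := xlt i
      obtain ⟨r1, r2, r3, r4⟩ := fin i (a - 1) _ hi hi1 hi2 (by rw [hk]; nlinarith)
        (by field_simp; ring)
      exact ⟨_, r1, r2, r3, by rw [r4, hk]; nlinarith⟩

/-! ### Visiting all three labels -/

/-- `h` and `v` are two different transpositions of a set of three labels. -/
def IsTranspositionPair {X : Type*} (h v : X → X) : Prop :=
  ∃ A B C : X, (∀ g, g = A ∨ g = B ∨ g = C) ∧
    h A = B ∧ h B = A ∧ h C = C ∧ v A = C ∧ v C = A ∧ v B = B

namespace IsTranspositionPair

variable {X : Type*} {h v : X → X}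

lemma symm (H : IsTranspositionPair h v) : IsTranspositionPair v h := by
  obtain ⟨A, B, C, h0, h1, h2, h3, h4, h5, h6⟩ := H
  exact ⟨A, C, B, fun g => by rcases h0 g with h | h | h <;> simp [h], h4, h5, h6, h1, h2, h3⟩

lemma involutive_left (H : IsTranspositionPair h v) : Function.Involutive h := by
  obtain ⟨A, B, C, h0, h1, h2, h3, h4, h5, h6⟩ := H
  intro g
  rcases h0 g with h | h | h <;> simp [h, h1, h2, h3]

lemma involutive_right (H : IsTranspositionPair h v) : Function.Involutive v :=
  H.symm.involutive_left

end IsTranspositionPair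

/-- Every orbit visits each label before time `N`. -/
def VisitsLabels {X : Type*} (θ : ℝ) (h v : X → X) (N : ℝ) : Prop :=
  ∀ x f, IsOrbit θ h v x f → ∀ g : X, ∃ m : ℕ, (m : ℝ) ≤ N ∧ f m = g

/-- Every orbit visits each label at a position which does not wrap around, before time `N`. -/
def VisitsLow {X : Type*} (θ : ℝ) (h v : X → X) (N : ℝ) : Prop :=
  ∀ x f, IsOrbit θ h v x f → ∀ g : X, ∃ m : ℕ, (m : ℝ) ≤ N ∧ f m = g ∧ x m ≤ 1 - θ

/-- Every orbit visits each label at a position which wraps around, before time `N`. -/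
def VisitsHigh {X : Type*} (θ : ℝ) (h v : X → X) (N : ℝ) : Prop :=
  ∀ x f, IsOrbit θ h v x f → ∀ g : X, ∃ m : ℕ, (m : ℝ) ≤ N ∧ f m = g ∧ 1 - θ ≤ x m

section

variable {X : Type*} {θ θ' : ℝ} {h v : X → X} {N : ℝ} {a : ℕ}

/-- The fixed label of the wrapping involution is visited soon by the renormalized orbit. -/
lemma IsOrbit.exists_label {x : ℕ → ℝ} {f : ℕ → X} (H : IsOrbit θ v h x f) (hθ : 0 < θ)
    {A B C : X} (h0 : ∀ g, g = A ∨ g = B ∨ g = C)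
    (h1 : h A = B) (h2 : h B = A) (h3 : h C = C) (h4 : v A = C) (h5 : v C = A) (h6 : v B = B) :
    (∃ i : ℕ, (i : ℝ) ≤ 1 / θ + 3 ∧ f i = B) ∧ (∃ i : ℕ, (i : ℝ) ≤ 1 / θ + 3 ∧ (f i = A ∨ f i = C)) := by
  have hθ' : 0 < 1 / θ := by positivity
  -- The label C is fixed by h, hence persists until the first wrap, which sends it to h (v C) = h A
  -- = B.
  have fromC : ∀ m, f m = C → ∃ i : ℕ, (i : ℝ) ≤ m + 1 / θ + 1 ∧ f i = B := by
    intro m hm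
    obtain ⟨j, hj1, hj2, hj3, hj4⟩ := H.exists_wrap hθ m
    have hl : f (m + j) = C := by
      rw [(H.run hθ m j hj1.le).2, hm, Function.iterate_fixed h3]
    refine ⟨m + (j + 1), ?_, ?_⟩
    · have : (j : ℝ) ≤ 1 / θ := by
        rw [le_div_iff₀ hθ]; linarith [H.pos m]
      push_cast; linarith
    · rw [← add_assoc, (H.of_gt (m := m + j) (by rw [hj3]; linarith)).2, hl, h5, h1]
  refine ⟨?_, ?_⟩
  · rcases h0 (f 0) with hf | hf | hf
    · rcases H.step 0 with ⟨-, hs⟩ | ⟨-, hs⟩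
      · refine ⟨1, ?_, by rw [hs, hf, h1]⟩
        push_cast; linarith
      · obtain ⟨i, hi, hi'⟩ := fromC 1 (by rw [hs, hf, h4, h3])
        refine ⟨i, ?_, hi'⟩
        push_cast at hi; linarith
    · exact ⟨0, by push_cast; linarith, hf⟩
    · obtain ⟨i, hi, hi'⟩ := fromC 0 hf
      refine ⟨i, ?_, hi'⟩
      push_cast at hi; linarith
  · rcases h0 (f 0) with hf | hf | hf
    · exact ⟨0, by push_cast; linarith, Or.inl hf⟩
    · refine ⟨1, by push_cast; linarith, Or.inl ?_⟩
      rcases H.step 0 with ⟨-, hs⟩ | ⟨-, hs⟩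
      · rw [hs, hf, h2]
      · rw [hs, hf, h6, h2]
    · exact ⟨0, by push_cast; linarith, Or.inr hf⟩

/-- The original orbit sees f (m i) on entry and v (f (m i)) one step later. So the renormalized
orbit only has to meet both v-classes {B} and {A, C}, which `IsOrbit.exists_label` provides. -/
lemma VisitsLabels.of_transpositionPair (hθ : 0 < θ) (ha : Even a) (ha2 : 2 ≤ a) (hθ' : 0 < θ')
    (hθ1' : θ' < 1) (e : (a + θ') * θ = 1) (H : IsTranspositionPair h v) :
    VisitsLabels θ h v ((1 / θ' + 5) / θ) := by
  intro x f hx g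
  have hv := H.involutive_right
  obtain ⟨m, hO, hm⟩ := hx.renormalize hθ ha ha2 hθ' hθ1' e hv
  obtain ⟨A, B, C, h0, h1, h2, h3, h4, h5, h6⟩ := H
  have ha2' : (2 : ℝ) ≤ a := by exact_mod_cast ha2
  have xlt : ∀ i, x (m i) < θ := fun i => by
    have := hO.pos i
    rw [← div_lt_one hθ]; linarith
  have vis : ∀ i : ℕ, (i : ℝ) ≤ 1 / θ' + 3 → (v (f (m i)) = g ∨ f (m i) = g) →
      ∃ m : ℕ, (m : ℝ) ≤ (1 / θ' + 5) / θ ∧ f m = g := by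
    rintro i hi (hg | hg)
    · obtain ⟨-, r1, r2⟩ := hm i 1 (by have := xlt i; push_cast; nlinarith)
      exact ⟨_, r2.trans (by gcongr ?_ / _; linarith), by rw [r1]; exact hg⟩
    · obtain ⟨-, r1, r2⟩ := hm i 0 (by have := hx.lt_one (m i); push_cast; linarith)
      exact ⟨_, r2.trans (by gcongr ?_ / _; linarith), by rw [r1]; exact hg⟩
  obtain ⟨⟨i, hi, hiB⟩, ⟨k, hk, hk'⟩⟩ := hO.exists_label hθ' h0 h1 h2 h3 h4 h5 h6
  have e2 : f (m k) = v (v (f (m k))) := (hv _).symm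
  rcases h0 g with rfl | rfl | rfl
  · apply vis k hk
    rcases hk' with h | h
    · exact Or.inl h
    · right; rw [e2, h, h5]
  · exact vis i hi (Or.inl hiB)
  · apply vis k hk
    rcases hk' with h | h
    · right; rw [e2, h, h4]
    · exact Or.inl h

/-- Entries lie below θ, and θ ≤ 1 - θ because a ≥ 2, so every entry is a low visit. -/
lemma VisitsLow.of_renormalized (hθ : 0 < θ) (ha : Even a) (ha2 : 2 ≤ a) (hθ' : 0 < θ')
    (hθ1' : θ' < 1) (e : (a + θ') * θ = 1) (hv : Function.Involutive v)
    (H : VisitsLabels θ' v h N) : VisitsLow θ h v ((N + 2) / θ) := by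
  intro x f hx g
  obtain ⟨m, hO, hm⟩ := hx.renormalize hθ ha ha2 hθ' hθ1' e hv
  obtain ⟨i, hi, hi'⟩ := H _ _ hO (v g)
  have ha2' : (2 : ℝ) ≤ a := by exact_mod_cast ha2
  have : x (m i) < θ := by
    have := hO.pos i
    rw [← div_lt_one hθ]; linarith
  obtain ⟨r0, r1, r2⟩ := hm i 0 (by have := hx.lt_one (m i); push_cast; linarith)
  exact ⟨m i, r2.trans (by gcongr), hv.injective hi', by nlinarith⟩

/-- A low renormalized point is an entry above θ'θ, and a - 1 steps carry it above (a - 1 + θ')θ = 1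
- θ. As a - 1 is odd, the label there is v (f (m i)), the renormalized one. -/
lemma VisitsHigh.of_renormalized (hθ : 0 < θ) (ha : Even a) (ha2 : 2 ≤ a) (hθ' : 0 < θ')
    (hθ1' : θ' < 1) (e : (a + θ') * θ = 1) (hv : Function.Involutive v)
    (H : VisitsLow θ' v h N) : VisitsHigh θ h v ((N + 2) / θ) := by
  intro x f hx g
  obtain ⟨m, hO, hm⟩ := hx.renormalize hθ ha ha2 hθ' hθ1' e hv
  obtain ⟨i, hi, hi', hl⟩ := H _ _ hO g
  have hxl : x (m i) < θ := by
    have := hO.pos i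
    rw [← div_lt_one hθ]; linarith
  have hxg : θ' * θ ≤ x (m i) := by
    rw [← le_div_iff₀ hθ]; linarith
  have hk : ((a - 1 : ℕ) : ℝ) = a - 1 := by rw [Nat.cast_sub (by omega)]; simp
  have hodd : Odd (a - 1) := Nat.Even.sub_odd (by omega) ha odd_one
  obtain ⟨r0, r1, r2⟩ := hm i (a - 1) (by rw [hk]; nlinarith)
  rw [hv.iterate_odd hodd] at r1
  exact ⟨_, r2.trans (by gcongr), r1.trans hi', by rw [r0, hk]; nlinarith⟩

end

/-! ### Iteration along the continued fraction -/

/-- The complete quotients of an infinite continued fraction with positive even digits `a`: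
`θ k = 1 / (a k + θ (k + 1))`. -/
structure IsEvenExpansion (θ : ℕ → ℝ) (a : ℕ → ℕ) : Prop where
  pos : ∀ k, 0 < θ k
  lt_one : ∀ k, θ k < 1
  eq : ∀ k, (a k + θ (k + 1)) * θ k = 1
  even : ∀ k, Even (a k)
  two_le : ∀ k, 2 ≤ a k

namespace IsEvenExpansion

variable {θ : ℕ → ℝ} {a : ℕ → ℕ}

lemma le_half (E : IsEvenExpansion θ a) (k : ℕ) : θ k ≤ 1 / 2 := by
  have h1 : (2 : ℝ) ≤ a k := by exact_mod_cast E.two_le k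
  have := E.eq k
  have := E.pos k
  have := E.pos (k + 1)
  nlinarith

lemma inv_le (E : IsEvenExpansion θ a) {M : ℝ} (hM : ∀ k, (a k : ℝ) ≤ M) (k : ℕ) :
    1 / θ k ≤ M + 1 := by
  have := E.eq k
  have := E.pos k
  have := E.lt_one (k + 1)
  have := hM k
  rw [div_le_iff₀ (E.pos k)]
  nlinarith

variable {X : Type*}

/-- At scale 1 closeness is automatic; only labels and sides matter. The bound must be uniform in k
and in the pair, because `recurs` starts from a shifted level, possibly with h and v interchanged.
-/
lemma recurs_one (E : IsEvenExpansion θ a) {M : ℝ} (hM : ∀ k, (a k : ℝ) ≤ M) :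
    ∃ N : ℝ, ∀ k, ∀ h v : X → X, IsTranspositionPair h v → Recurs (θ k) h v 1 N := by
  set D := M + 1
  have hD : 1 ≤ D := by
    have : (0 : ℝ) ≤ a 0 := by positivity
    linarith [hM 0]
  have le : ∀ k (N N' : ℝ), 0 ≤ N' → N ≤ N' → N / θ k ≤ N' * D := by
    intro k N N' h0 hN
    rw [div_eq_mul_one_div]
    have := E.inv_le hM k
    have : 0 < 1 / θ k := by have := E.pos k; positivity
    nlinarith
  have v1 : ∀ k, ∀ h v : X → X, IsTranspositionPair h v →
      VisitsLabels (θ k) h v ((D + 5) * D) := by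
    intro k h v H x f hx g
    obtain ⟨m, hm, hm'⟩ := VisitsLabels.of_transpositionPair (E.pos k) (E.even k) (E.two_le k)
      (E.pos (k + 1)) (E.lt_one _) (E.eq k) H x f hx g
    exact ⟨m, hm.trans (le _ _ _ (by positivity) (by linarith [E.inv_le hM (k + 1)])), hm'⟩
  have v2 : ∀ k, ∀ h v : X → X, IsTranspositionPair h v →
      VisitsLow (θ k) h v (((D + 5) * D + 2) * D) := by
    intro k h v H x f hx g
    obtain ⟨m, hm, hm'⟩ := VisitsLow.of_renormalized (E.pos k) (E.even k) (E.two_le k)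
      (E.pos (k + 1)) (E.lt_one _) (E.eq k) H.involutive_right (v1 (k + 1) v h H.symm) x f hx g
    exact ⟨m, hm.trans (le _ _ _ (by positivity) le_rfl), hm'⟩
  have v3 : ∀ k, ∀ h v : X → X, IsTranspositionPair h v →
      VisitsHigh (θ k) h v ((((D + 5) * D + 2) * D + 2) * D) := by
    intro k h v H x f hx g
    obtain ⟨m, hm, hm'⟩ := VisitsHigh.of_renormalized (E.pos k) (E.even k) (E.two_le k)
      (E.pos (k + 1)) (E.lt_one _) (E.eq k) H.involutive_right (v2 (k + 1) v h H.symm) x f hx g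
    exact ⟨m, hm.trans (le _ _ _ (by positivity) le_rfl), hm'⟩
  refine ⟨(((D + 5) * D + 2) * D + 2) * D, fun k h v H x f hx g y => ⟨fun h1 h2 => ?_,
    fun h1 h2 => ?_⟩⟩
  · obtain ⟨m, hm, hm1, hm2⟩ := v2 k h v H x f hx g
    refine ⟨m, hm.trans ?_, ?_, hm1, hm2⟩
    · have : 0 ≤ ((D + 5) * D + 2) * D := by positivity
      nlinarith
    · have := hx.pos m
      have := hx.lt_one m
      have := E.pos k
      rw [abs_le]; constructor <;> linarith
  · obtain ⟨m, hm, hm1, hm2⟩ := v3 k h v H x f hx g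
    refine ⟨m, hm, ?_, hm1, hm2⟩
    have := hx.pos m
    have := hx.lt_one m
    have := E.lt_one k
    rw [abs_le]; constructor <;> linarith

/-- The term -4 closes the induction: one step replaces it by (-4 + 2)/θ = -2/θ, which is at most -4
since θ ≤ 1/2. -/
lemma recurs (E : IsEvenExpansion θ a) {N : ℝ} (hN : ∀ k, ∀ h v : X → X,
    IsTranspositionPair h v → Recurs (θ k) h v 1 N) (n : ℕ) :
    ∀ k, ∀ h v : X → X, IsTranspositionPair h v →
      Recurs (θ k) h v (∏ i ∈ Finset.range n, θ (k + i))
        ((N + 4) / (∏ i ∈ Finset.range n, θ (k + i)) - 4) := by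
  induction n with
  | zero => intro k h v H; simpa using hN k h v H
  | succ n ih =>
    intro k h v H
    have hp : ∏ i ∈ Finset.range (n + 1), θ (k + i) =
        θ k * ∏ i ∈ Finset.range n, θ (k + 1 + i) := by
      rw [Finset.prod_range_succ', mul_comm]
      simp only [add_zero]
      congr 1
      refine Finset.prod_congr rfl fun i _ => by congr 1; ring
    rw [hp]
    have hP : 0 < ∏ i ∈ Finset.range n, θ (k + 1 + i) := Finset.prod_pos fun i _ => E.pos _
    have hk := E.pos k
    refine (Recurs.of_renormalized (E.pos k) (E.even k) (E.two_le k) (E.pos (k + 1))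
      (E.lt_one _) (E.eq k) H.involutive_right (ih (k + 1) v h H.symm)).mono ?_
    have h2 : 4 ≤ 2 / θ k := by
      rw [le_div_iff₀ hk]; linarith [E.le_half k]
    have e : ((N + 4) / (∏ i ∈ Finset.range n, θ (k + 1 + i)) - 4 + 2) / θ k =
        (N + 4) / (θ k * ∏ i ∈ Finset.range n, θ (k + 1 + i)) - 2 / θ k := by
      field_simp; ring
    rw [e]; linarith

/-- Quantitative recurrence: orbits are `1 / K`-dense before time `O(K)`. -/
lemma exists_recurs (E : IsEvenExpansion θ a) {M : ℝ} (hM : ∀ k, (a k : ℝ) ≤ M)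
    {h v : X → X} (H : IsTranspositionPair h v) :
    ∃ D : ℝ, 0 < D ∧ ∀ K : ℝ, 1 ≤ K → ∃ ε, ε ≤ 1 / K ∧ Recurs (θ 0) h v ε (D * K) := by
  obtain ⟨N, hN⟩ := E.recurs_one (X := X) hM
  have hM0 : 0 ≤ M := (Nat.cast_nonneg (a 0)).trans (hM 0)
  refine ⟨(|N| + 4) * (M + 1), by positivity, fun K hK => ?_⟩
  set P : ℕ → ℝ := fun n => ∏ i ∈ Finset.range n, θ (0 + i)
  have hP : ∀ n, 0 < P n := fun n => Finset.prod_pos fun i _ => E.pos _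
  have hs : ∀ n, P (n + 1) = P n * θ n := fun n => by
    simp only [P, Finset.prod_range_succ, zero_add]
  have hex : ∃ n, P n ≤ 1 / K := by
    have hb : ∀ n, P n ≤ (1 / 2) ^ n := by
      intro n
      induction n with
      | zero => simp [P]
      | succ n ih =>
        rw [hs, pow_succ]
        exact mul_le_mul ih (E.le_half n) (E.pos n).le (by positivity)
    obtain ⟨n, hn⟩ := exists_pow_lt_of_lt_one (show 0 < 1 / K by positivity)
      (show (1 / 2 : ℝ) < 1 by norm_num)
    exact ⟨n, (hb n).trans hn.le⟩
  classical
  set n := Nat.find hex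
  -- By minimality of n the previous product exceeds 1/K, and one more factor costs at most M + 1.
  have hlow : 1 / P n ≤ (M + 1) * K := by
    rcases Nat.eq_zero_or_pos n with h0 | h0
    · rw [h0]; simp only [P, Finset.range_zero, Finset.prod_empty]; nlinarith
    · have h1 := Nat.find_min hex (Nat.sub_one_lt h0.ne')
      push Not at h1
      obtain ⟨k, hk⟩ : ∃ k, n = k + 1 := ⟨n - 1, by omega⟩
      have hk1 : Nat.find hex - 1 = k := by omega
      rw [hk1] at h1
      have h2 := E.inv_le hM k
      rw [hk, hs, ← one_div_mul_one_div_rev]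
      have h3 : 1 / P k ≤ K := by
        rw [one_div_le (hP k) (by positivity)]; exact h1.le
      have := E.pos k
      have := hP k
      gcongr
  refine ⟨P n, Nat.find_spec hex, (E.recurs hN n 0 h v H).mono ?_⟩
  have h1 : (N + 4) / P n ≤ (|N| + 4) * (1 / P n) := by
    rw [div_eq_mul_one_div]
    have := hP n
    gcongr
    exact le_abs_self N
  have h2 : (|N| + 4) * (1 / P n) ≤ (|N| + 4) * ((M + 1) * K) := by gcongr
  change (N + 4) / P n - 4 ≤ _
  linarith

end IsEvenExpansion

/-! ### Complete quotients of α -/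

lemma exists_isEvenExpansion {α : ℝ} (hbad : IsBadlyApproximable α) {a : ℕ → ℕ}
    (ha : HasContFracDigits α a) (hdigits : ∀ i, 0 < a i ∧ Even (a i)) :
    ∃ θ : ℕ → ℝ, IsEvenExpansion θ a ∧ θ 0 = 1 / α ∧ ∃ M : ℝ, ∀ k, (a k : ℝ) ≤ M := by
  have htwo : ∀ k, 2 ≤ a k := fun k => by
    obtain ⟨h1, r, hr⟩ := hdigits k
    omega
  have hst : ∀ i, ∃ p, GenContFract.IntFractPair.stream α i = some p ∧ (p.b : ℝ) = a i := by
    intro i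
    cases i with
    | zero =>
      refine ⟨_, rfl, ?_⟩
      have := ha.1
      rwa [GenContFract.of_h_eq_floor] at this
    | succ i =>
      obtain ⟨g, hg1, hg2⟩ := GenContFract.exists_s_b_of_partDen (ha.2 i)
      obtain ⟨p, hp1, hp2⟩ := GenContFract.IntFractPair.exists_succ_get?_stream_of_gcf_of_get?_eq_some hg1
      exact ⟨p, hp1, by rw [hp2, hg2]⟩
  choose p hp1 hp2 using hst
  have hfr : ∀ i, 0 ≤ (p i).fr ∧ (p i).fr < 1 := fun i =>
    ⟨GenContFract.IntFractPair.nth_stream_fr_nonneg (hp1 i),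
      GenContFract.IntFractPair.nth_stream_fr_lt_one (hp1 i)⟩
  have hsucc : ∀ i, (p i).fr ≠ 0 ∧ (a (i + 1) + (p (i + 1)).fr) * (p i).fr = 1 := by
    intro i
    obtain ⟨q, hq1, hq2, hq3⟩ :=
      GenContFract.IntFractPair.succ_nth_stream_eq_some_iff.1 (hp1 (i + 1))
    rw [hp1 i] at hq1
    obtain rfl := Option.some.inj hq1
    refine ⟨hq2, ?_⟩
    rw [← hp2 (i + 1), ← hq3]
    simp only [GenContFract.IntFractPair.of]
    rw [Int.floor_add_fract, inv_mul_cancel₀ hq2]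
  have h0 : (a 0 : ℝ) + (p 0).fr = α := by
    have : p 0 = GenContFract.IntFractPair.of α := (Option.some.inj (hp1 0)).symm
    rw [← hp2 0, this]
    exact Int.floor_add_fract α
  have ha0 : (2 : ℝ) ≤ a 0 := by exact_mod_cast htwo 0
  have hα : 2 ≤ α := by linarith [(hfr 0).1]
  -- The sequence starts at 1/α rather than at the fractional part of α, so that a 0 is the digit of
  -- the first renormalization.
  refine ⟨fun k => Nat.casesOn k (1 / α) fun i => (p i).fr, ⟨?_, ?_, ?_, fun k => (hdigits k).2,
    htwo⟩, rfl, ?_⟩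
  · rintro (_ | i)
    · change 0 < 1 / α; positivity
    · exact lt_of_le_of_ne (hfr i).1 (hsucc i).1.symm
  · rintro (_ | i)
    · change 1 / α < 1
      rw [div_lt_one (by linarith)]; linarith
    · exact (hfr i).2
  · rintro (_ | i)
    · change ((a 0 : ℝ) + (p 0).fr) * (1 / α) = 1
      rw [h0]; field_simp
    · exact (hsucc i).2
  · obtain ⟨C, hC⟩ := hbad.2
    -- The assumed bound concerns partial denominators only, so a 0 is added by hand.
    refine ⟨max (a 0) C, ?_⟩
    rintro (_ | i)
    · exact le_max_left _ _
    · exact (hC i _ (ha.2 i)).trans (le_max_right _ _)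

/-! ### Local coordinates on the L-surface -/

namespace LSurface

/-- Abscissa of the lower left corner of a square: the squares `0`, `1`, `2` have
lower left corners `(0, 0)`, `(1, 0)`, `(0, 1)`. -/
def cornerX (s : Fin 3) : ℝ := if s = 1 then 1 else 0

/-- Ordinate of the lower left corner of a square. -/
def cornerY (s : Fin 3) : ℝ := if s = 2 then 1 else 0

/-- The square to the right (equivalently, to the left) of a square. -/
def right : Fin 3 → Fin 3 := ![1, 0, 2]

/-- The square above (equivalently, below) a square. -/
def up : Fin 3 → Fin 3 := ![2, 1, 0]

lemma isTranspositionPair_right_up : IsTranspositionPair right up :=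
  ⟨0, 1, 2, by decide, rfl, rfl, rfl, rfl, rfl, rfl⟩

/-- The point with local coordinates `(x, y)` in the square `s`. For `σ = 1` these are measured from
the lower left corner, for `σ = -1` from the upper right corner, in the opposite directions. -/
def chart (σ : ℝ) (s : Fin 3) (x y : ℝ) : EuclideanSpace ℝ (Fin 2) :=
  !₂[cornerX s + (1 / 2 + σ * (x - 1 / 2)), cornerY s + (1 / 2 + σ * (y - 1 / 2))]

@[simp] lemma chart_zero (σ : ℝ) (s : Fin 3) (x y : ℝ) :
    chart σ s x y 0 = cornerX s + (1 / 2 + σ * (x - 1 / 2)) := rfl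

@[simp] lemma chart_one (σ : ℝ) (s : Fin 3) (x y : ℝ) :
    chart σ s x y 1 = cornerY s + (1 / 2 + σ * (y - 1 / 2)) := rfl

lemma plane_ext {p q : EuclideanSpace ℝ (Fin 2)} (h0 : p 0 = q 0) (h1 : p 1 = q 1) : p = q := by
  ext i; fin_cases i
  · exact h0
  · exact h1

variable {σ : ℝ} {s s' : Fin 3} {x y x' y' : ℝ} {z : LSurface}

lemma chart_mem (hσ : σ = 1 ∨ σ = -1) (hx : 0 ≤ x) (hx1 : x ≤ 1) (hy : 0 ≤ y) (hy1 : y ≤ 1) :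
    chart σ s x y ∈ LShape := by
  simp only [LShape, Set.mem_ofPred_eq, chart_zero, chart_one, Set.mem_Icc]
  rcases hσ with rfl | rfl <;> fin_cases s <;> simp [cornerX, cornerY] <;> grind

/-- The point `z` of the surface has local coordinates `(x, y)` in the square `s`. -/
def Rep (z : LSurface) (σ : ℝ) (s : Fin 3) (x y : ℝ) : Prop :=
  ∃ h : chart σ s x y ∈ LShape, z = mk ⟨chart σ s x y, h⟩

lemma mk_eq_of_glue {p q : LShape} (h : LGlue p q ∨ LGlue q p) : mk p = mk q := by
  rcases h with h | h
  · exact Quot.sound h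
  · exact (Quot.sound h).symm

/-- For σ = -1 the edge x = 1 is the left edge of the square. The same label map serves because left
and right neighbours coincide, so both directions of travel are treated at once. -/
lemma Rep.right (hσ : σ = 1 ∨ σ = -1) (hy : 0 ≤ y) (hy1 : y ≤ 1) (h : Rep z σ s 1 y) :
    Rep z σ (right s) 0 y := by
  obtain ⟨h, rfl⟩ := h
  refine ⟨chart_mem hσ le_rfl zero_le_one hy hy1, ?_⟩
  rcases hσ with rfl | rfl <;> fin_cases s
  · congr 2
    apply plane_ext <;> simp [LSurface.right, cornerX, cornerY]
  · refine mk_eq_of_glue (Or.inr (.v₁ _ _ ?_ ?_ ?_ ?_)) <;>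
      simp [LSurface.right, cornerX, cornerY] <;> grind
  · refine mk_eq_of_glue (Or.inr (.v₂ _ _ ?_ ?_ ?_ ?_)) <;>
      simp [LSurface.right, cornerX, cornerY] <;> grind
  · refine mk_eq_of_glue (Or.inl (.v₁ _ _ ?_ ?_ ?_ ?_)) <;>
      simp [LSurface.right, cornerX, cornerY] <;> grind
  · congr 2
    apply plane_ext <;> simp [LSurface.right, cornerX, cornerY]; norm_num
  · refine mk_eq_of_glue (Or.inl (.v₂ _ _ ?_ ?_ ?_ ?_)) <;>
      simp [LSurface.right, cornerX, cornerY] <;> grind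

lemma Rep.up (hσ : σ = 1 ∨ σ = -1) (hx : 0 ≤ x) (hx1 : x ≤ 1) (h : Rep z σ s x 1) :
    Rep z σ (up s) x 0 := by
  obtain ⟨h, rfl⟩ := h
  refine ⟨chart_mem hσ hx hx1 le_rfl zero_le_one, ?_⟩
  rcases hσ with rfl | rfl <;> fin_cases s
  · congr 2
    apply plane_ext <;> simp [LSurface.up, cornerX, cornerY]
  · refine mk_eq_of_glue (Or.inr (.h₂ _ _ ?_ ?_ ?_ ?_)) <;>
      simp [LSurface.up, cornerX, cornerY] <;> grind
  · refine mk_eq_of_glue (Or.inr (.h₁ _ _ ?_ ?_ ?_ ?_)) <;>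
      simp [LSurface.up, cornerX, cornerY] <;> grind
  · refine mk_eq_of_glue (Or.inl (.h₁ _ _ ?_ ?_ ?_ ?_)) <;>
      simp [LSurface.up, cornerX, cornerY] <;> grind
  · refine mk_eq_of_glue (Or.inl (.h₂ _ _ ?_ ?_ ?_ ?_)) <;>
      simp [LSurface.up, cornerX, cornerY] <;> grind
  · congr 2
    apply plane_ext <;> simp [LSurface.up, cornerX, cornerY]; norm_num

lemma congr_of_mk_eq {β : Type*} (φ : LShape → β) (hφ : ∀ p q, LGlue p q → φ p = φ q)
    {p q : LShape} (h : mk p = mk q) : φ p = φ q :=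
  congrArg (Quot.lift φ hφ) h

/-- The possible integer coordinates of points of the net. -/
def IsGrid (r : ℝ) : Prop := r = 0 ∨ r = 1 ∨ r = 2

lemma isVertex_mk {p : LShape} (h0 : IsGrid (p.1 0)) (h1 : IsGrid (p.1 1)) : (mk p).IsVertex := by
  have aux : ∀ r : ℝ, IsGrid r → ∃ i : ℤ, r = i := by
    rintro r (rfl | rfl | rfl)
    exacts [⟨0, by simp⟩, ⟨1, by simp⟩, ⟨2, by simp⟩]
  obtain ⟨i, hi⟩ := aux _ h0
  obtain ⟨j, hj⟩ := aux _ h1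
  exact ⟨p, i, j, hi, hj, rfl⟩

open Classical in
/-- Points of the net off the grid lines are not identified with any other point. -/
lemma eq_of_mk_eq {p q : LShape} (h : mk p = mk q) (h0 : ¬ IsGrid (q.1 0))
    (h1 : ¬ IsGrid (q.1 1)) : p.1 = q.1 := by
  have := congr_of_mk_eq (fun p : LShape =>
    if IsGrid (p.1 0) ∨ IsGrid (p.1 1) then none else some p.1) (by
      rintro p q (⟨-, -, h1, h2⟩ | ⟨-, -, h1, h2⟩ | ⟨-, -, h1, h2⟩ | ⟨-, -, h1, h2⟩) <;>
        simp [IsGrid, h1, h2]) h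
  grind

open Classical in
/-- The representative of a point in the half-open squares containing their left and
lower edges; `none` at vertices. -/
def lowerRep (p : LShape) : Option (ℝ × ℝ) :=
  if IsGrid (p.1 0) ∧ IsGrid (p.1 1) then none else
    some (if p.1 0 = 2 ∨ (p.1 0 = 1 ∧ 1 < p.1 1) then 0 else p.1 0,
      if p.1 1 = 2 ∨ (p.1 1 = 1 ∧ 1 < p.1 0) then 0 else p.1 1)

open Classical in
/-- The representative of a point in the half-open squares containing their right and
upper edges; `none` at vertices. -/
def upperRep (p : LShape) : Option (ℝ × ℝ) :=
  if IsGrid (p.1 0) ∧ IsGrid (p.1 1) then none else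
    some (if p.1 0 = 0 then (if p.1 1 ≤ 1 then 2 else 1) else p.1 0,
      if p.1 1 = 0 then (if p.1 0 ≤ 1 then 2 else 1) else p.1 1)

/-- Being invariant under each gluing, `lowerRep` and `upperRep` descend to the quotient and
separate its non-vertex points, without any description of the generated equivalence relation. -/
lemma lowerRep_congr (p q : LShape) (h : LGlue p q) : lowerRep p = lowerRep q := by
  rcases h with ⟨h0, h1, h2, h3⟩ | ⟨h0, h1, h2, h3⟩ | ⟨h0, h1, h2, h3⟩ | ⟨h0, h1, h2, h3⟩ <;>
    simp only [lowerRep, IsGrid, h1, h2, h3, Set.mem_Icc] at h0 ⊢ <;> grind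

lemma upperRep_congr (p q : LShape) (h : LGlue p q) : upperRep p = upperRep q := by
  rcases h with ⟨h0, h1, h2, h3⟩ | ⟨h0, h1, h2, h3⟩ | ⟨h0, h1, h2, h3⟩ | ⟨h0, h1, h2, h3⟩ <;>
    simp only [upperRep, IsGrid, h1, h2, h3, Set.mem_Icc] at h0 ⊢ <;> grind

lemma chart_injective (hσ : σ = 1 ∨ σ = -1) (hx : 0 ≤ x) (hx1 : x < 1) (hy : 0 ≤ y) (hy1 : y < 1)
    (hx' : 0 ≤ x') (hx1' : x' < 1) (hy' : 0 ≤ y') (hy1' : y' < 1)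
    (h0 : chart σ s x y 0 = chart σ s' x' y' 0) (h1 : chart σ s x y 1 = chart σ s' x' y' 1) :
    s = s' ∧ x = x' ∧ y = y' := by
  replace h0 : cornerX s + (1 / 2 + σ * (x - 1 / 2)) = cornerX s' + (1 / 2 + σ * (x' - 1 / 2)) := h0
  replace h1 : cornerY s + (1 / 2 + σ * (y - 1 / 2)) = cornerY s' + (1 / 2 + σ * (y' - 1 / 2)) := h1
  rcases hσ with rfl | rfl <;> fin_cases s <;> fin_cases s' <;>
    simp [cornerX, cornerY] at h0 h1 ⊢ <;> grind

lemma lowerRep_chart (hx : 0 ≤ x) (hx1 : x < 1) (hy : 0 ≤ y) (hy1 : y < 1)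
    (h : chart 1 s x y ∈ LShape) (hv : ¬ (mk ⟨_, h⟩).IsVertex) :
    lowerRep ⟨_, h⟩ = some (chart 1 s x y 0, chart 1 s x y 1) := by
  have hv' : ¬ (IsGrid (chart 1 s x y 0) ∧ IsGrid (chart 1 s x y 1)) :=
    fun h => hv (isVertex_mk h.1 h.2)
  rw [lowerRep, if_neg hv']
  simp only [chart_zero, chart_one, Option.some.injEq, Prod.mk.injEq]
  clear hv hv'
  fin_cases s <;> simp [cornerX, cornerY] <;> grind

lemma upperRep_chart (hx : 0 ≤ x) (hx1 : x < 1) (hy : 0 ≤ y) (hy1 : y < 1)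
    (h : chart (-1) s x y ∈ LShape) (hv : ¬ (mk ⟨_, h⟩).IsVertex) :
    upperRep ⟨_, h⟩ = some (chart (-1) s x y 0, chart (-1) s x y 1) := by
  have hv' : ¬ (IsGrid (chart (-1) s x y 0) ∧ IsGrid (chart (-1) s x y 1)) :=
    fun h => hv (isVertex_mk h.1 h.2)
  rw [upperRep, if_neg hv']
  simp only [chart_zero, chart_one, Option.some.injEq, Prod.mk.injEq]
  clear hv hv'
  fin_cases s <;> simp [cornerX, cornerY] <;> grind

lemma Rep.unique (hσ : σ = 1 ∨ σ = -1) (hz : ¬ z.IsVertex)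
    (hx : 0 ≤ x) (hx1 : x < 1) (hy : 0 ≤ y) (hy1 : y < 1)
    (hx' : 0 ≤ x') (hx1' : x' < 1) (hy' : 0 ≤ y') (hy1' : y' < 1)
    (h : Rep z σ s x y) (h' : Rep z σ s' x' y') : s = s' ∧ x = x' ∧ y = y' := by
  obtain ⟨m, rfl⟩ := h
  obtain ⟨m', e⟩ := h'
  have hz' := hz
  rw [e] at hz'
  have key : chart σ s x y 0 = chart σ s' x' y' 0 ∧ chart σ s x y 1 = chart σ s' x' y' 1 := by
    rcases hσ with rfl | rfl
    · have := congr_of_mk_eq _ lowerRep_congr e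
      rw [lowerRep_chart hx hx1 hy hy1 m hz, lowerRep_chart hx' hx1' hy' hy1' m' hz'] at this
      simpa only [Option.some.injEq, Prod.mk.injEq] using this
    · have := congr_of_mk_eq _ upperRep_congr e
      rw [upperRep_chart hx hx1 hy hy1 m hz, upperRep_chart hx' hx1' hy' hy1' m' hz'] at this
      simpa only [Option.some.injEq, Prod.mk.injEq] using this
  exact chart_injective hσ hx hx1 hy hy1 hx' hx1' hy' hy1' key.1 key.2

lemma mem_LShape {p : EuclideanSpace ℝ (Fin 2)} (hp : p ∈ LShape) :
    ∃ X Y : ℝ, p 0 = X ∧ p 1 = Y ∧ 0 ≤ X ∧ 0 ≤ Y ∧ ((X ≤ 2 ∧ Y ≤ 1) ∨ (X ≤ 1 ∧ Y ≤ 2)) := by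
  refine ⟨p 0, p 1, rfl, rfl, ?_⟩
  rcases hp with ⟨⟨h1, h2⟩, h3, h4⟩ | ⟨⟨h1, h2⟩, h3, h4⟩
  · exact ⟨h1, h3, Or.inl ⟨h2, h4⟩⟩
  · exact ⟨h1, h3, Or.inr ⟨h2, h4⟩⟩

lemma eq_chart (hσ : σ = 1 ∨ σ = -1) {p : EuclideanSpace ℝ (Fin 2)} {X Y : ℝ} (hX : p 0 = X)
    (hY : p 1 = Y) (s : Fin 3) :
    p = chart σ s (1 / 2 + σ * (X - cornerX s - 1 / 2)) (1 / 2 + σ * (Y - cornerY s - 1 / 2)) := by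
  refine plane_ext ?_ ?_ <;> rcases hσ with rfl | rfl <;> simp [hX, hY]

/-- Points from which one can move into the net in the direction `σ • (+, +)`. -/
lemma exists_chart_of_leaves (hσ : σ = 1 ∨ σ = -1) {p q : EuclideanSpace ℝ (Fin 2)}
    (hp : p ∈ LShape) (hq : q ∈ LShape) {c d : ℝ} (hc : 0 < c) (hd : 0 < d)
    (h0 : q 0 = p 0 + σ * c) (h1 : q 1 = p 1 + σ * d) :
    ∃ s x y, 0 ≤ x ∧ x < 1 ∧ 0 ≤ y ∧ y < 1 ∧ p = chart σ s x y := by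
  obtain ⟨X, Y, hX, hY, b1, b2, b3⟩ := mem_LShape hp
  obtain ⟨X', Y', hX', hY', c1, c2, c3⟩ := mem_LShape hq
  have e0 : X' = X + σ * c := by rw [← hX', h0, hX]
  have e1 : Y' = Y + σ * d := by rw [← hY', h1, hY]
  suffices ∃ s, 0 ≤ 1 / 2 + σ * (X - cornerX s - 1 / 2) ∧
      1 / 2 + σ * (X - cornerX s - 1 / 2) < 1 ∧ 0 ≤ 1 / 2 + σ * (Y - cornerY s - 1 / 2) ∧
      1 / 2 + σ * (Y - cornerY s - 1 / 2) < 1 by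
    obtain ⟨s, a1, a2, a3, a4⟩ := this
    exact ⟨s, _, _, a1, a2, a3, a4, eq_chart hσ hX hY s⟩
  clear hX hY hX' hY' h0 h1 hp hq
  subst e0 e1
  rcases hσ with rfl | rfl
  · by_cases a : 1 ≤ X
    · refine ⟨1, ?_⟩; simp [cornerX, cornerY]; grind
    · by_cases b : 1 ≤ Y
      · refine ⟨2, ?_⟩; simp [cornerX, cornerY]; grind
      · refine ⟨0, ?_⟩; simp [cornerX, cornerY]; grind
  · by_cases a : 1 < X
    · refine ⟨1, ?_⟩; simp [cornerX, cornerY]; grind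
    · by_cases b : 1 < Y
      · refine ⟨2, ?_⟩; simp [cornerX, cornerY]; grind
      · refine ⟨0, ?_⟩; simp [cornerX, cornerY]; grind

lemma exists_chart (hσ : σ = 1 ∨ σ = -1) {p : EuclideanSpace ℝ (Fin 2)} (hp : p ∈ LShape) :
    ∃ s x y, 0 ≤ x ∧ x ≤ 1 ∧ 0 ≤ y ∧ y ≤ 1 ∧ p = chart σ s x y := by
  obtain ⟨X, Y, hX, hY, b1, b2, b3⟩ := mem_LShape hp
  suffices ∃ s, 0 ≤ 1 / 2 + σ * (X - cornerX s - 1 / 2) ∧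
      1 / 2 + σ * (X - cornerX s - 1 / 2) ≤ 1 ∧ 0 ≤ 1 / 2 + σ * (Y - cornerY s - 1 / 2) ∧
      1 / 2 + σ * (Y - cornerY s - 1 / 2) ≤ 1 by
    obtain ⟨s, a1, a2, a3, a4⟩ := this
    exact ⟨s, _, _, a1, a2, a3, a4, eq_chart hσ hX hY s⟩
  clear hX hY hp
  by_cases a : 1 < X
  · refine ⟨1, ?_⟩; rcases hσ with rfl | rfl <;> simp [cornerX, cornerY] <;> grind
  · by_cases b : 1 < Y
    · refine ⟨2, ?_⟩; rcases hσ with rfl | rfl <;> simp [cornerX, cornerY] <;> grind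
    · refine ⟨0, ?_⟩; rcases hσ with rfl | rfl <;> simp [cornerX, cornerY] <;> grind

lemma not_isGrid_chart (hσ : σ = 1 ∨ σ = -1) (hx : 0 < x) (hx1 : x < 1) (hy : 0 < y) (hy1 : y < 1) :
    ¬ IsGrid (chart σ s x y 0) ∧ ¬ IsGrid (chart σ s x y 1) := by
  simp only [IsGrid, chart_zero, chart_one]
  rcases hσ with rfl | rfl <;> fin_cases s <;> simp [cornerX, cornerY] <;> grind

lemma Rep.isVertex (hσ : σ = 1 ∨ σ = -1) (hx : x = 0 ∨ x = 1) (hy : y = 0 ∨ y = 1)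
    (h : Rep z σ s x y) : z.IsVertex := by
  obtain ⟨m, rfl⟩ := h
  apply isVertex_mk <;> simp only [IsGrid, chart_zero, chart_one] <;>
    rcases hσ with rfl | rfl <;> rcases hx with rfl | rfl <;> rcases hy with rfl | rfl <;>
    fin_cases s <;> simp [cornerX, cornerY] <;> norm_num

lemma flatEDist_le_of_rep (hσ : σ = 1 ∨ σ = -1) {z' : LSurface}
    (hx : 0 ≤ x) (hx1 : x ≤ 1) (hy : 0 ≤ y) (hy1 : y ≤ 1)
    (hx' : 0 ≤ x') (hx1' : x' ≤ 1) (hy' : 0 ≤ y') (hy1' : y' ≤ 1)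
    (h : Rep z σ s x y) (h' : Rep z' σ s x' y') :
    flatEDist z z' ≤ ENNReal.ofReal (|x - x'| + |y - y'|) := by
  obtain ⟨m, rfl⟩ := h
  obtain ⟨m', rfl⟩ := h'
  have hseg : segment ℝ (chart σ s x y) (chart σ s x' y') ⊆ LShape := by
    rintro _ ⟨a, b, ha, hb, hab, rfl⟩
    have hb' : b = 1 - a := by linarith
    have e : a • chart σ s x y + b • chart σ s x' y' =
        chart σ s (a * x + b * x') (a * y + b * y') := by
      subst hb'
      apply plane_ext <;> simp <;> ring
    rw [e]
    exact chart_mem hσ (by positivity) (by nlinarith) (by positivity) (by nlinarith)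
  have hd : dist (chart σ s x y) (chart σ s x' y') ≤ |x - x'| + |y - y'| := by
    rw [EuclideanSpace.dist_eq, Fin.sum_univ_two, Real.dist_eq, Real.dist_eq]
    simp only [chart_zero, chart_one]
    rw [Real.sqrt_le_iff]
    refine ⟨by positivity, ?_⟩
    rw [sq_abs, sq_abs]
    have : 0 ≤ |x - x'| * |y - y'| := by positivity
    have e1 := sq_abs (x - x')
    have e2 := sq_abs (y - y')
    rcases hσ with rfl | rfl <;> nlinarith
  refine (iInf₂_le _ (IsPath.step _ _ IsPath.nil hseg)).trans ?_
  rw [zero_add]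
  exact ENNReal.ofReal_le_ofReal hd

end LSurface

/-! ### Coding geodesics by horizontal crossings -/

namespace LSurface

variable {v : EuclideanSpace ℝ (Fin 2)} {γ : ℝ → LSurface} {σ w₁ w₂ : ℝ}

/-- The curve `γ` leaves at time `t` from the point `(x, y)` of the square `s`, with velocity
`(w₁, w₂)` in local coordinates. -/
def Leaves (γ : ℝ → LSurface) (σ w₁ w₂ t : ℝ) (s : Fin 3) (x y : ℝ) : Prop :=
  ∃ δ : ℝ, 0 < δ ∧ ∀ u, 0 ≤ u → u ≤ δ → Rep (γ (t + u)) σ s (x + u * w₁) (y + u * w₂)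

lemma chart_add (h0 : v 0 = σ * w₁) (h1 : v 1 = σ * w₂) (s : Fin 3) (x y u : ℝ) :
    chart σ s x y + u • v = chart σ s (x + u * w₁) (y + u * w₂) := by
  apply plane_ext <;> simp [h0, h1] <;> ring

namespace IsHalfGeodesic

lemma exists_leaves (G : IsHalfGeodesic v γ) (hσ : σ = 1 ∨ σ = -1) (hw₁ : 0 < w₁) (hw₂ : 0 < w₂)
    (h0 : v 0 = σ * w₁) (h1 : v 1 = σ * w₂) {t : ℝ} (ht : 0 ≤ t) :
    ∃ s x y, 0 ≤ x ∧ x < 1 ∧ 0 ≤ y ∧ y < 1 ∧ Leaves γ σ w₁ w₂ t s x y := by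
  obtain ⟨p, ε, hε, H⟩ := G.leaves t ht
  obtain ⟨m0, -⟩ := H 0 ⟨le_rfl, hε.le⟩
  obtain ⟨m1, -⟩ := H ε ⟨hε.le, le_rfl⟩
  rw [zero_smul, add_zero] at m0
  obtain ⟨s, x, y, hx, hx1, hy, hy1, rfl⟩ := exists_chart_of_leaves hσ m0 m1
    (mul_pos hε hw₁) (mul_pos hε hw₂) (by simp [h0]; ring) (by simp [h1]; ring)
  refine ⟨s, x, y, hx, hx1, hy, hy1, ε, hε, fun u hu hu' => ?_⟩
  have := H u ⟨hu, hu'⟩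
  simp only [chart_add h0 h1] at this
  exact this

/-- Away from vertices half-open coordinates are unique, so the chart in which the geodesic departs
is the given one. -/
lemma leaves_of_rep (G : IsHalfGeodesic v γ) (hσ : σ = 1 ∨ σ = -1) (hw₁ : 0 < w₁) (hw₂ : 0 < w₂)
    (h0 : v 0 = σ * w₁) (h1 : v 1 = σ * w₂) {t : ℝ} (ht : 0 < t) {s : Fin 3} {x y : ℝ}
    (hx : 0 ≤ x) (hx1 : x < 1) (hy : 0 ≤ y) (hy1 : y < 1) (h : Rep (γ t) σ s x y) :
    Leaves γ σ w₁ w₂ t s x y := by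
  obtain ⟨s', x', y', hx', hx1', hy', hy1', δ, hδ, H⟩ :=
    G.exists_leaves hσ hw₁ hw₂ h0 h1 ht.le
  have h2 := H 0 le_rfl hδ.le
  simp only [zero_mul, add_zero] at h2
  obtain ⟨rfl, rfl, rfl⟩ := Rep.unique hσ (G.avoids_vertices t ht) hx hx1 hy hy1 hx' hx1' hy' hy1'
    h h2
  exact ⟨δ, hδ, H⟩

/-- A geodesic continues straight until it leaves the closed square. -/
lemma follow (G : IsHalfGeodesic v γ) (hσ : σ = 1 ∨ σ = -1) (hw₁ : 0 < w₁) (hw₂ : 0 < w₂)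
    (h0 : v 0 = σ * w₁) (h1 : v 1 = σ * w₂) {t : ℝ} (ht : 0 ≤ t) {s : Fin 3} {x y : ℝ}
    (hx : 0 ≤ x) (hy : 0 ≤ y) (h : Leaves γ σ w₁ w₂ t s x y) {u : ℝ} (hu : 0 ≤ u)
    (hxu : x + u * w₁ ≤ 1) (hyu : y + u * w₂ ≤ 1) :
    Rep (γ (t + u)) σ s (x + u * w₁) (y + u * w₂) := by
  by_contra hbad
  obtain ⟨δ, hδ, H⟩ := h
  set F : Set ℝ := {r | 0 ≤ r ∧ ¬ Rep (γ (t + r)) σ s (x + r * w₁) (y + r * w₂)}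
  have huF : u ∈ F := ⟨hu, hbad⟩
  have hbdd : BddBelow F := ⟨0, fun r hr => hr.1⟩
  set r₀ := sInf F
  have hle : r₀ ≤ u := csInf_le hbdd huF
  have hpos : 0 < r₀ := by
    refine lt_of_lt_of_le hδ (le_csInf ⟨u, huF⟩ fun r hr => ?_)
    by_contra hlt
    exact hr.2 (H r hr.1 (not_le.1 hlt).le)
  have below : ∀ r, 0 ≤ r → r < r₀ → Rep (γ (t + r)) σ s (x + r * w₁) (y + r * w₂) := by
    intro r hr hrr
    by_contra hn
    exact absurd (csInf_le hbdd ⟨hr, hn⟩) (not_le.2 hrr)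
  -- Shortly before r₀ the point is inside the open square, where its representative in the net is
  -- unique. This pins down the segment given by `arrives`, up to its end point.
  have at₀ : Rep (γ (t + r₀)) σ s (x + r₀ * w₁) (y + r₀ * w₂) := by
    obtain ⟨p, ε, hε, A⟩ := G.arrives (t + r₀) (by linarith)
    set d := min ε (r₀ / 2)
    have hd : 0 < d := lt_min hε (by linarith)
    have hd1 : d ≤ ε := min_le_left _ _
    have hd2 : d ≤ r₀ / 2 := min_le_right _ _
    obtain ⟨m, e⟩ := A d ⟨hd.le, hd1⟩
    obtain ⟨m', e'⟩ := below (r₀ - d) (by linarith) (by linarith)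
    rw [show t + (r₀ - d) = t + r₀ - d by ring, e] at e'
    have hin := not_isGrid_chart (s := s) hσ (x := x + (r₀ - d) * w₁) (y := y + (r₀ - d) * w₂)
      (by nlinarith) (by nlinarith) (by nlinarith) (by nlinarith)
    have hp : p - d • v = _ := eq_of_mk_eq e' hin.1 hin.2
    have hp' : p = chart σ s (x + r₀ * w₁) (y + r₀ * w₂) := by
      rw [sub_eq_iff_eq_add.1 hp, chart_add h0 h1]
      congr 1 <;> ring
    obtain ⟨m0, e0⟩ := A 0 ⟨le_rfl, hε.le⟩
    simp only [zero_smul, sub_zero, hp'] at m0 e0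
    exact ⟨m0, e0⟩
  -- If r₀ < u, the point at r₀ is still interior, so the segment given by `leaves` extends the
  -- chart past the infimum of the bad times.
  rcases hle.lt_or_eq with hlt | heq
  · obtain ⟨p, ε, hε, A⟩ := G.leaves (t + r₀) (by linarith)
    obtain ⟨m0, e0⟩ := A 0 ⟨le_rfl, hε.le⟩
    obtain ⟨m', e'⟩ := at₀
    rw [add_zero] at e0
    rw [e0] at e'
    have hin := not_isGrid_chart (s := s) hσ (x := x + r₀ * w₁) (y := y + r₀ * w₂)
      (by nlinarith) (by nlinarith) (by nlinarith) (by nlinarith)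
    have hp : p + (0 : ℝ) • v = _ := eq_of_mk_eq e' hin.1 hin.2
    rw [zero_smul, add_zero] at hp
    subst hp
    obtain ⟨r, hr, hr'⟩ := exists_lt_of_csInf_lt ⟨u, huF⟩ (show sInf F < r₀ + ε by linarith)
    have hr0 : r₀ ≤ r := csInf_le hbdd hr
    have : Rep (γ (t + r₀ + (r - r₀))) σ s (x + r₀ * w₁ + (r - r₀) * w₁)
        (y + r₀ * w₂ + (r - r₀) * w₂) := by
      have := A (r - r₀) ⟨by linarith, by linarith⟩
      simp only [chart_add h0 h1] at this
      exact this
    apply hr.2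
    rw [show t + r₀ + (r - r₀) = t + r by ring,
      show x + r₀ * w₁ + (r - r₀) * w₁ = x + r * w₁ by ring,
      show y + r₀ * w₂ + (r - r₀) * w₂ = y + r * w₂ by ring] at this
    exact this
  · rw [heq] at at₀
    exact hbad at₀

/-- A geodesic which goes up leaves a square through its right edge if it gets there first. -/
lemma cross_right (G : IsHalfGeodesic v γ) (hσ : σ = 1 ∨ σ = -1) (hw₁ : 0 < w₁) (hw₂ : 0 < w₂)
    (h0 : v 0 = σ * w₁) (h1 : v 1 = σ * w₂) {t : ℝ} (ht : 0 ≤ t) {s : Fin 3} {x y : ℝ}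
    (hx : 0 ≤ x) (hx1 : x < 1) (hy : 0 ≤ y) (h : Leaves γ σ w₁ w₂ t s x y)
    (hc : y + (1 - x) * (w₂ / w₁) < 1) :
    Leaves γ σ w₁ w₂ (t + (1 - x) / w₁) (right s) 0 (y + (1 - x) * (w₂ / w₁)) := by
  have hτ : 0 < (1 - x) / w₁ := div_pos (by linarith) hw₁
  have e1 : x + (1 - x) / w₁ * w₁ = 1 := by field_simp; ring
  have e2 : y + (1 - x) / w₁ * w₂ = y + (1 - x) * (w₂ / w₁) := by ring
  have hy' : 0 ≤ y + (1 - x) * (w₂ / w₁) := by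
    have : 0 ≤ (1 - x) * (w₂ / w₁) := mul_nonneg (by linarith) (by positivity)
    linarith
  have := G.follow hσ hw₁ hw₂ h0 h1 ht hx hy h hτ.le e1.le (by rw [e2]; exact hc.le)
  rw [e1, e2] at this
  exact G.leaves_of_rep hσ hw₁ hw₂ h0 h1 (by linarith) le_rfl zero_lt_one hy' hc
    (this.right hσ hy' hc.le)

/-- The next crossing of a horizontal edge by a steep geodesic. -/
lemma cross_up (G : IsHalfGeodesic v γ) (hσ : σ = 1 ∨ σ = -1) (hw₁ : 0 < w₁) (hw : w₁ < w₂)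
    (h0 : v 0 = σ * w₁) (h1 : v 1 = σ * w₂) {t : ℝ} (ht : 0 ≤ t) {s : Fin 3} {x y : ℝ}
    (hx : 0 ≤ x) (hx1 : x < 1) (hy : 0 ≤ y) (hy1 : y < 1) (h : Leaves γ σ w₁ w₂ t s x y) :
    ∃ s' x', 0 < x' ∧ x' < 1 ∧ Rep (γ (t + (1 - y) / w₂)) σ s' x' 0 ∧
      ((x' = x + (1 - y) * (w₁ / w₂) ∧ s' = up s) ∨
        (x' = x + (1 - y) * (w₁ / w₂) - 1 ∧ s' = up (right s))) := by
  have hw₂ : 0 < w₂ := hw₁.trans hw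
  set θ := w₁ / w₂ with hθ
  have hθ0 : 0 < θ := by positivity
  have hθ1 : θ < 1 := (div_lt_one hw₂).2 hw
  have hτ : 0 < (1 - y) / w₂ := div_pos (by linarith) hw₂
  have e1 : y + (1 - y) / w₂ * w₂ = 1 := by field_simp; ring
  have e2 : x + (1 - y) / w₂ * w₁ = x + (1 - y) * θ := by rw [hθ]; ring
  have hyθ : 0 < (1 - y) * θ := mul_pos (by linarith) hθ0
  rcases le_or_gt (x + (1 - y) * θ) 1 with hc | hc
  · have := G.follow hσ hw₁ hw₂ h0 h1 ht hx hy h hτ.le (by rw [e2]; exact hc) e1.le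
    rw [e1, e2] at this
    refine ⟨up s, x + (1 - y) * θ, by linarith, ?_, this.up hσ (by linarith) hc, Or.inl ⟨rfl, rfl⟩⟩
    -- Equality would mean hitting the corner of the square, a vertex.
    refine lt_of_le_of_ne hc fun he => G.avoids_vertices (t + (1 - y) / w₂) (by linarith) ?_
    exact this.isVertex hσ (Or.inr he) (Or.inr rfl)
  · have hwθ : w₂ / w₁ * θ = 1 := by rw [hθ]; field_simp
    have hi : 0 < w₂ / w₁ := by positivity
    have hy' : y + (1 - x) * (w₂ / w₁) < 1 := by nlinarith
    have h' := G.cross_right hσ hw₁ hw₂ h0 h1 ht hx hx1 hy h hy'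
    set y' := y + (1 - x) * (w₂ / w₁) with hy'def
    have hy0 : 0 < y' := by
      have : 0 < (1 - x) * (w₂ / w₁) := mul_pos (by linarith) hi
      linarith
    have ht' : 0 ≤ t + (1 - x) / w₁ := by
      have : 0 < (1 - x) / w₁ := div_pos (by linarith) hw₁
      linarith
    have e3 : y' + (1 - y') / w₂ * w₂ = 1 := by field_simp; ring
    have e4 : 0 + (1 - y') / w₂ * w₁ = x + (1 - y) * θ - 1 := by
      rw [hy'def, hθ]; field_simp; ring
    have e5 : t + (1 - x) / w₁ + (1 - y') / w₂ = t + (1 - y) / w₂ := by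
      rw [hy'def]; field_simp; ring
    have hlt : x + (1 - y) * θ - 1 < 1 := by nlinarith
    have := G.follow hσ hw₁ hw₂ h0 h1 ht' le_rfl hy0.le h'
      (div_nonneg (by linarith) hw₂.le) (by rw [e4]; exact hlt.le) e3.le
    rw [e3, e4, e5] at this
    exact ⟨_, _, by linarith, hlt, this.up hσ (by linarith) hlt.le, Or.inr ⟨rfl, rfl⟩⟩

/-- The successive crossings of horizontal edges by a steep geodesic. -/
lemma exists_isOrbit (G : IsHalfGeodesic v γ) (hσ : σ = 1 ∨ σ = -1) (hw₁ : 0 < w₁) (hw : w₁ < w₂)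
    (h0 : v 0 = σ * w₁) (h1 : v 1 = σ * w₂) :
    ∃ (t₀ : ℝ) (x : ℕ → ℝ) (f : ℕ → Fin 3), 0 < t₀ ∧ t₀ ≤ 1 / w₂ ∧
      IsOrbit (w₁ / w₂) right up x f ∧
      ∀ m : ℕ, Leaves γ σ w₁ w₂ (t₀ + m / w₂) (f m) (x m) 0 := by
  have hw₂ : 0 < w₂ := hw₁.trans hw
  obtain ⟨s, x, y, hx, hx1, hy, hy1, hL⟩ := G.exists_leaves hσ hw₁ hw₂ h0 h1 le_rfl
  obtain ⟨s₀, x₀, hx₀, hx₀1, hR, -⟩ := G.cross_up hσ hw₁ hw h0 h1 le_rfl hx hx1 hy hy1 hL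
  rw [zero_add] at hR
  set t₀ := (1 - y) / w₂
  have ht₀ : 0 < t₀ := div_pos (by linarith) hw₂
  let S (m : ℕ) : Type :=
    {p : ℝ × Fin 3 // 0 < p.1 ∧ p.1 < 1 ∧ Rep (γ (t₀ + m / w₂)) σ p.2 p.1 0}
  have hpos : ∀ m : ℕ, 0 < t₀ + m / w₂ := fun m => by positivity
  have next : ∀ (m : ℕ) (p : S m), ∃ q : S (m + 1),
      (q.1.1 = p.1.1 + w₁ / w₂ ∧ q.1.2 = up p.1.2) ∨
        (q.1.1 = p.1.1 + w₁ / w₂ - 1 ∧ q.1.2 = up (right p.1.2)) := by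
    rintro m ⟨⟨a, b⟩, ha, ha1, hab⟩
    obtain ⟨s', x', q0, q1, q2, q3⟩ := G.cross_up hσ hw₁ hw h0 h1 (hpos m).le ha.le ha1 le_rfl
      zero_lt_one (G.leaves_of_rep hσ hw₁ hw₂ h0 h1 (hpos m) ha.le ha1 le_rfl zero_lt_one hab)
    rw [show t₀ + m / w₂ + (1 - 0) / w₂ = t₀ + ((m + 1 : ℕ) : ℝ) / w₂ by push_cast; ring] at q2
    refine ⟨⟨(x', s'), q0, q1, q2⟩, ?_⟩
    simpa using q3
  choose g hg using next
  let o : ∀ m, S m := fun m => Nat.rec ⟨(x₀, s₀), hx₀, hx₀1, by simpa using hR⟩ g m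
  refine ⟨t₀, fun m => (o m).1.1, fun m => (o m).1.2, ht₀, ?_,
    ⟨fun m => (o m).2.1, fun m => (o m).2.2.1, fun m => hg m (o m)⟩, fun m => ?_⟩
  · exact div_le_div_of_nonneg_right (by linarith) hw₂.le
  · exact G.leaves_of_rep hσ hw₁ hw₂ h0 h1 (hpos m) (o m).2.1.le (o m).2.2.1 le_rfl zero_lt_one
      (o m).2.2.2

set_option maxHeartbeats 1000000 in
/-- If the coding of a steep geodesic is recurrent, then the geodesic gets close to
each point of each square. -/
lemma exists_rep_near (G : IsHalfGeodesic v γ) (hσ : σ = 1 ∨ σ = -1) (hw₁ : 0 < w₁) (hw : w₁ < w₂)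
    (h0 : v 0 = σ * w₁) (h1 : v 1 = σ * w₂) {ε N : ℝ} (R : Recurs (w₁ / w₂) right up ε N)
    (s : Fin 3) {a b : ℝ} (ha : 0 ≤ a) (ha1 : a ≤ 1) (hb : 0 ≤ b) (hb1 : b ≤ 1) :
    ∃ t x y, 0 ≤ t ∧ t ≤ (N + 2) / w₂ ∧ 0 ≤ x ∧ x ≤ 1 ∧ 0 ≤ y ∧ y ≤ 1 ∧ Rep (γ t) σ s x y ∧
      |x - a| ≤ ε * (w₂ / w₁) ∧ |y - b| ≤ ε * (w₂ / w₁) := by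
  have hw₂ : 0 < w₂ := hw₁.trans hw
  obtain ⟨t₀, z, f, ht₀, ht₀', hO, hL⟩ := G.exists_isOrbit hσ hw₁ hw h0 h1
  set θ := w₁ / w₂ with hθ
  have hθ0 : 0 < θ := by positivity
  have hθ1 : θ < 1 := (div_lt_one hw₂).2 hw
  have hi : w₂ / w₁ = θ⁻¹ := by rw [hθ, inv_div]
  have hi1 : 1 ≤ w₂ / w₁ := (one_le_div hw₁).2 hw.le
  have hiθ : w₂ / w₁ * θ = 1 := by rw [hi, inv_mul_cancel₀ hθ0.ne']
  have hi0 : 0 < w₂ / w₁ := by positivity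
  have e21 : ∀ u, u / w₂ * w₁ = u * θ := fun u => by rw [hθ]; ring
  have e12 : ∀ u, u / w₁ * w₂ = u * (w₂ / w₁) := fun u => by ring
  have hbθ : 0 ≤ b * θ := by positivity
  have hbθ1 : b * θ ≤ θ := by nlinarith
  have time : ∀ (m : ℕ) (u : ℝ), (m : ℝ) ≤ N → u ≤ 1 → t₀ + m / w₂ + u / w₂ ≤ (N + 2) / w₂ := by
    intro m u hm hu
    have : (m : ℝ) / w₂ ≤ N / w₂ := by gcongr
    have : u / w₂ ≤ 1 / w₂ := by gcongr
    have : (N + 2) / w₂ = N / w₂ + 1 / w₂ + 1 / w₂ := by ring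
    linarith
  have htm : ∀ m : ℕ, 0 < t₀ + m / w₂ := fun m => by positivity
  -- Flowing back from (a, b) reaches height 0 at abscissa a - bθ: in s itself if this is
  -- nonnegative, otherwise at a - bθ + 1 in the left neighbour, which is `right s`.
  rcases le_or_gt 0 (a - b * θ) with hab | hab
  · obtain ⟨m, hm, hd, hf⟩ : ∃ m : ℕ, (m : ℝ) ≤ N ∧ |z m - (a - b * θ)| ≤ ε ∧ f m = s := by
      obtain ⟨R1, R2⟩ := R z f hO s (a - b * θ)
      rcases le_total (a - b * θ) (1 - θ) with hc | hc
      · obtain ⟨m, r1, r2, r3, -⟩ := R1 hab hc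
        exact ⟨m, r1, r2, r3⟩
      · obtain ⟨m, r1, r2, r3, -⟩ := R2 hc (by linarith)
        exact ⟨m, r1, r2, r3⟩
    have hε : 0 ≤ ε := (abs_nonneg _).trans hd
    have hεi : ε ≤ ε * (w₂ / w₁) := le_mul_of_one_le_right hε hi1
    rw [abs_le] at hd
    have hz0 := hO.pos m
    have hz1 := hO.lt_one m
    have hLm := hL m
    rw [hf] at hLm
    rcases le_or_gt (z m + b * θ) 1 with hc | hc
    · have := G.follow hσ hw₁ hw₂ h0 h1 (htm m).le hz0.le le_rfl hLm (u := b / w₂)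
        (by positivity) (by rw [e21]; exact hc) (by rw [div_mul_cancel₀ _ hw₂.ne']; linarith)
      rw [e21, div_mul_cancel₀ _ hw₂.ne', zero_add] at this
      refine ⟨_, _, _, ?_, time m b hm hb1, by linarith, hc, hb, hb1, this, ?_, ?_⟩
      · have := htm m; positivity
      · rw [abs_le]; constructor <;> linarith
      · simpa using hε.trans hεi
    -- The flow meets the right edge no higher than b. Stopping there costs at most ε in x and ε/θ
    -- in y.
    · have hy1 : (1 - z m) * (w₂ / w₁) ≤ b := by
        have : (1 - z m) * (w₂ / w₁) ≤ b * θ * (w₂ / w₁) := by gcongr; linarith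
        nlinarith
      have hy0 : 0 < (1 - z m) * (w₂ / w₁) := mul_pos (by linarith) hi0
      have e1 : z m + (1 - z m) / w₁ * w₁ = 1 := by field_simp; ring
      have := G.follow hσ hw₁ hw₂ h0 h1 (htm m).le hz0.le le_rfl hLm (u := (1 - z m) / w₁)
        (div_nonneg (by linarith) hw₁.le) e1.le (by rw [e12]; linarith)
      rw [e1, e12, zero_add] at this
      refine ⟨_, _, _, ?_, ?_, zero_le_one, le_rfl, hy0.le, hy1.trans hb1, this, ?_, ?_⟩
      · have := htm m
        have : 0 ≤ (1 - z m) / w₁ := div_nonneg (by linarith) hw₁.le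
        linarith
      · rw [show (1 - z m) / w₁ = (1 - z m) * (w₂ / w₁) / w₂ by field_simp]
        exact time m _ hm (hy1.trans hb1)
      · rw [abs_le]; constructor <;> linarith
      · have hk : b - (1 - z m) * (w₂ / w₁) = (b * θ - (1 - z m)) * (w₂ / w₁) := by
          linear_combination (-b) * hiθ
        have hk' : (b * θ - (1 - z m)) * (w₂ / w₁) ≤ ε * (w₂ / w₁) := by
          gcongr; linarith
        rw [abs_le]; constructor
        · linarith
        · have : 0 ≤ ε * (w₂ / w₁) := by positivity
          linarith
  -- The side condition is essential here: it forces the flow to cross the right edge into s, which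
  -- nearness alone would not.
  · obtain ⟨m, hm, hd, hf, hs⟩ := (R z f hO (right s) (a - b * θ + 1)).2 (by linarith) (by linarith)
    have hε : 0 ≤ ε := (abs_nonneg _).trans hd
    have hεi : ε ≤ ε * (w₂ / w₁) := le_mul_of_one_le_right hε hi1
    rw [abs_le] at hd
    have hz0 := hO.pos m
    have hz1 := hO.lt_one m
    have hs' : 1 < z m + θ := by
      by_contra hn
      have := (hO.of_lt (not_lt.1 hn)).1
      linarith
    have hLm := hL m
    rw [hf] at hLm
    have hy1 : 0 + (1 - z m) * (w₂ / w₁) < 1 := by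
      have : (1 - z m) * (w₂ / w₁) < θ * (w₂ / w₁) := by gcongr; linarith
      linarith
    have hy0 : 0 < (1 - z m) * (w₂ / w₁) := mul_pos (by linarith) hi0
    have hLr := G.cross_right hσ hw₁ hw₂ h0 h1 (htm m).le hz0.le hz1 le_rfl hLm hy1
    rw [isTranspositionPair_right_up.involutive_left, zero_add] at hLr
    rw [zero_add] at hy1
    set y := (1 - z m) * (w₂ / w₁) with hy
    have hyθ : y * θ = 1 - z m := by rw [hy, mul_assoc, hiθ, mul_one]
    have ey : (1 - z m) / w₁ = y / w₂ := by rw [hy]; field_simp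
    rw [ey] at hLr
    have htm' : 0 < t₀ + m / w₂ + y / w₂ := by have := htm m; positivity
    rcases le_or_gt y b with hc | hc
    · have hbyθ : (b - y) * θ = b * θ - (1 - z m) := by rw [sub_mul, hyθ]
      have hb' : (b - y) * θ ≤ 1 := by linarith
      have e3 : y + (b - y) / w₂ * w₂ = b := by field_simp; ring
      have := G.follow hσ hw₁ hw₂ h0 h1 htm'.le le_rfl hy0.le hLr (u := (b - y) / w₂)
        (div_nonneg (by linarith) hw₂.le) (by rw [e21, zero_add]; exact hb') (by rw [e3]; exact hb1)
      rw [e21, e3, zero_add, show t₀ + m / w₂ + y / w₂ + (b - y) / w₂ = t₀ + m / w₂ + b / w₂ by ring]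
        at this
      refine ⟨_, _, _, ?_, time m b hm hb1, mul_nonneg (by linarith) hθ0.le, hb', hb, hb1, this,
        ?_, ?_⟩
      · have := htm m; positivity
      · rw [abs_le]; constructor <;> linarith
      · simpa using hε.trans hεi
    -- The flow enters s above height b; the entry point itself is within ε in x and ε/θ in y.
    · obtain ⟨δ, hδ, HL⟩ := hLr
      have := HL 0 le_rfl hδ.le
      simp only [zero_mul, add_zero] at this
      have hybθ : (y - b) * θ = 1 - z m - b * θ := by rw [sub_mul, hyθ]
      have hyb : (y - b) * θ ≤ ε := by linarith
      have hyb' : y - b ≤ ε * (w₂ / w₁) := by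
        have : (y - b) * θ * (w₂ / w₁) ≤ ε * (w₂ / w₁) := by gcongr
        rwa [mul_assoc, mul_comm θ, hiθ, mul_one] at this
      refine ⟨_, _, _, htm'.le, time m y hm hy1.le, le_rfl, zero_le_one, hy0.le, hy1.le, this,
        ?_, ?_⟩
      · have : (y - b) * θ > 0 := mul_pos (by linarith) hθ0
        rw [abs_le]; constructor <;> linarith
      · have : 0 ≤ ε * (w₂ / w₁) := by positivity
        rw [abs_le]; constructor <;> linarith

end IsHalfGeodesic
end LSurface

end

/-! ### Superdensity -/

theorem theorem6p1p1 (α : ℝ) (hα : 1 < α) (hbad : IsBadlyApproximable α)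
    (a : ℕ → ℕ) (ha : HasContFracDigits α a) (hdigits : ∀ i, 0 < a i ∧ Even (a i)) :
    ∃ C : ℝ, 0 < C ∧
      ∀ v : EuclideanSpace ℝ (Fin 2), ‖v‖ = 1 → v 1 = α * v 0 →
        ∀ γ : ℝ → LSurface, LSurface.IsHalfGeodesic v γ → LSurface.IsSuperdenseWith C γ := by
  obtain ⟨θ, E, hθ, M, hM⟩ := exists_isEvenExpansion hbad ha hdigits
  obtain ⟨D, hD, hrec⟩ := E.exists_recurs hM LSurface.isTranspositionPair_right_up
  rw [hθ] at hrec
  have hα0 : 0 < α := by linarith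
  -- At scale K = 3αn each coordinate error is at most 1/(3n), and their sum stays below 1/n. The
  -- time is (DK + 2)/w₂ with vertical speed w₂ ≥ 1/2, whence the factor 2.
  refine ⟨2 * (3 * α * D + 2), by positivity, fun v hv hslope γ G n hn P => ?_⟩
  have hn' : (1 : ℝ) ≤ n := by exact_mod_cast hn
  obtain ⟨c, hc⟩ : ∃ c : ℝ, c = v 0 := ⟨_, rfl⟩
  obtain ⟨d, hd⟩ : ∃ d : ℝ, d = v 1 := ⟨_, rfl⟩
  have hdc : d = α * c := by rw [hd, hc, hslope]
  have hunit : c ^ 2 + d ^ 2 = 1 := by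
    have := EuclideanSpace.real_norm_sq_eq v
    rw [hv, Fin.sum_univ_two, ← hc, ← hd] at this
    linarith
  have hc0 : c ≠ 0 := by
    rintro rfl
    rw [hdc] at hunit
    simp at hunit
  -- Positive slope gives both components of v the same sign σ.
  obtain ⟨σ, hσ, hσc⟩ : ∃ σ : ℝ, (σ = 1 ∨ σ = -1) ∧ c = σ * |c| := by
    rcases hc0.lt_or_gt with h | h
    · exact ⟨-1, Or.inr rfl, by rw [abs_of_neg h]; ring⟩
    · exact ⟨1, Or.inl rfl, by rw [abs_of_pos h]; ring⟩
  have hw₁ : 0 < |c| := abs_pos.2 hc0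
  have hw₂ : 0 < α * |c| := by positivity
  have hw : |c| < α * |c| := by nlinarith
  have hσd : d = σ * (α * |c|) := by
    rw [hdc]; linear_combination α * hσc
  have hhalf : 1 / 2 ≤ α * |c| := by
    have e := sq_abs c
    rw [hdc, mul_pow, ← e, ← mul_pow] at hunit
    by_contra hlt
    have h2 : (α * |c|) ^ 2 < (1 / 2) ^ 2 := pow_lt_pow_left₀ (not_le.1 hlt) hw₂.le two_ne_zero
    have h3 : |c| ^ 2 < (α * |c|) ^ 2 := pow_lt_pow_left₀ hw hw₁.le two_ne_zero
    linarith
  have hquot : |c| / (α * |c|) = 1 / α := by field_simp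
  have hquot' : α * |c| / |c| = α := by field_simp
  obtain ⟨ε, hε, R⟩ := hrec (3 * α * n) (by nlinarith)
  obtain ⟨p, rfl⟩ : ∃ p, LSurface.mk p = P := Quot.exists_rep P
  obtain ⟨s, r₀, r₁, hr0, hr01, hr1, hr11, hp⟩ := LSurface.exists_chart hσ p.2
  obtain ⟨t, x, y, ht, ht', hx, hx1, hy, hy1, hrep, hdx, hdy⟩ :=
    G.exists_rep_near hσ hw₁ hw (hc.symm.trans hσc) (hd.symm.trans hσd) (hquot ▸ R) s hr0 hr01 hr1 hr11
  rw [hquot'] at hdx hdy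
  have hP : LSurface.Rep (LSurface.mk p) σ s r₀ r₁ := by
    obtain ⟨p, hp'⟩ := p
    subst hp
    exact ⟨hp', rfl⟩
  refine ⟨t, ⟨ht, ht'.trans ?_⟩, (LSurface.flatEDist_le_of_rep hσ hx hx1 hy hy1 hr0 hr01 hr1 hr11
    hrep hP).trans_lt ?_⟩
  · rw [div_le_iff₀ hw₂]
    have h1 : 0 < D * (3 * α * n) := by positivity
    have h2 : D * (3 * α * n) + 2 ≤ (3 * α * D + 2) * n := by nlinarith
    have h3 : 0 ≤ (3 * α * D + 2) * n := by positivity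
    nlinarith
  · have h1 : ε * α ≤ 1 / (3 * n) := by
      calc ε * α ≤ 1 / (3 * α * n) * α := by gcongr
        _ = 1 / (3 * n) := by field_simp
    have h2 : 1 / (3 * (n : ℝ)) = 1 / n / 3 := by field_simp
    have h3 : 0 < 1 / (n : ℝ) := by positivity
    rw [ENNReal.ofReal_lt_ofReal_iff h3]
    linarith
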